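/- **Setting.** Let $T$ be a tree on $n\ge 2$ nodes, rooted at a depot $r$, with edge weights $w(e)\in\mathbb{Z}_{\ge 0}$, let $Q\ge 2$ be the vehicle capacity, and let $\mathcal I$ be given by demands (numbers of tokens) $d(v)\in\mathbb{Z}_{\ge 0}$ with $d(v)\ge 1$ for every $v\neq r$. A *tour* is a closed walk in $T$ from $r$ that picks up at most $Q$ tokens in total, at nodes it visits; its cost is the total weight of the walk. A *solution* is a finite collection (with repetitions) of tours such that every token is picked up by exactly one tour, and $\mathrm{opt}$ is the minimum total cost of a solution of $\mathcal I$. For a node $v$ let $T_v$ be the subtree rooted at $v$; the *size* at $v$ of (the partial tour of) a tour is the number of tokens it picks up in $T_v$. For $\varepsilon>0$ the *threshold values* $\sigma_1<\dots<\sigma_\tau$ are given by $\sigma_i=i$ for $i\le\lceil 1/\varepsilon\rceil$ and $\sigma_i=\lceil(1+\varepsilon)\sigma_{i-1}\rceil$ for $i>\lceil 1/\varepsilon\rceil$, the sequence being stopped at the first value that is at least $Q$, which is replaced by $\sigma_\tau=Q$; put $\sigma_{\tau+1}=Q+1$. The *$i$-th bucket* of $v$ consists of the tours whose size at $v$ lies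 in $[\sigma_i,\sigma_{i+1})$. For a constant $\alpha$, it is *small* if it contains at most $\alpha\log^3 n/\varepsilon^2$ tours, and *big* otherwise. Here $\log$ is the natural logarithm. **Theorem (Structure Theorem for trees).** For every constant $\delta>0$ there are constants $\alpha\ge\max\{1,12\delta\}$ and $C>0$, depending only on $\delta$, such that the following holds for every $0<\varepsilon<1$ and every instance $\mathcal I$ as above whose tree has height (largest number of edges on a path from $r$ to a node) at most $\delta\log^2 n/\varepsilon$. There are an instance $\mathcal I'$ on the same tree (same depot, weights and capacity) with demands $d'(v)\ge\max\{1,d(v)\}$ at every node $v$, and a solution $\mathrm{OPT}'$ of $\mathcal I'$ of cost at most $(1+4\varepsilon)\,\mathrm{opt}$, such that for every node $v$: 1. the tours of $\mathrm{OPT}'$ have at most $C\,\dfrac{\log Q\,\log^3 n}{\varepsilon^3}$ distinct sizes at $v$; 2. every bucket $i\ge 1$ of $v$ is either small, or it is big and, with $g=\lceil 2\delta\log^2 n/\varepsilon^2\rceil$, there are $g$ group sizes $\sigma_i\le h_1\le\dots\le h_g<\sigma_{i+1}$ such that every tour of $\mathrm{OPT}'$ in this bucket has one of these sizes at $v$.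 -/

import Mathlib

/-- A rooted, edge-weighted tree on the vertex set `V`, the root being the depot, together with
the capacity of the vehicle.  Demands are kept separate, so that several instances can live on
the same tree. -/
structure TreeNetwork (V : Type*) where
  graph : SimpleGraph V
  isTree : graph.IsTree
  depot : V
  weight : Sym2 V → ℕ
  capacity : ℕ

namespace TreeNetwork

variable {V : Type*} [Fintype V]

/-- A tour: a closed walk from the depot, with the number `load v` of tokens that it picks up at
each node `v`.  It picks up tokens only at nodes that it visits, and at most `capacity` in total. -/
structure Tour (N : TreeNetwork V) where
  route : N.graph.Walk N.depot N.depot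
  load : V → ℕ
  visits : ∀ v, load v ≠ 0 → v ∈ route.support
  load_le : ∑ v, load v ≤ N.capacity

/-- The cost of a tour: the total weight of its walk, each edge counted as often as traversed. -/
def Tour.cost {N : TreeNetwork V} (t : N.Tour) : ℕ :=
  (t.route.edges.map N.weight).sum

/-- The total cost of a finite collection of tours. -/
def cost {N : TreeNetwork V} (S : Multiset N.Tour) : ℕ :=
  (S.map Tour.cost).sum

/-- `S` is a solution for the demands `d`: each of the `d v` tokens at `v` is picked up by exactly
one tour. -/
def IsSolution {N : TreeNetwork V} (S : Multiset N.Tour) (d : V → ℕ) : Prop :=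
  ∀ v, (S.map fun t => t.load v).sum = d v

/-- The minimum cost of a solution for the demands `d`. -/
noncomputable def opt (N : TreeNetwork V) (d : V → ℕ) : ℕ :=
  sInf {c | ∃ S : Multiset N.Tour, IsSolution S d ∧ cost S = c}

open Classical in
/-- The vertex set of the subtree rooted at `v`: the vertices that can be reached from the depot
only through `v`. -/
noncomputable def subtree (N : TreeNetwork V) (v : V) : Finset V :=
  Finset.univ.filter fun u => ∀ p : N.graph.Walk N.depot u, v ∈ p.support

/-- The size (coverage) of the partial tour of `t` in the subtree rooted at `v`. -/
noncomputable def Tour.coverage {N : TreeNetwork V} (t : N.Tour) (v : V) : ℕ :=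
  ∑ u ∈ N.subtree v, t.load u

/-- The set of all sizes of partial tours of `S` in the subtree rooted at `v`. -/
noncomputable def sizes {N : TreeNetwork V} (S : Multiset N.Tour) (v : V) : Finset ℕ :=
  (S.map fun t => t.coverage v).toFinset

/-- The threshold sequence before it is cut off at the capacity: `i` for `i ≤ ⌈1/ε⌉`, and
`⌈(1 + ε) * previous⌉` from there on. -/
noncomputable def rawThreshold (ε : ℝ) : ℕ → ℕ
  | 0 => 0
  | i + 1 => if i + 1 ≤ ⌈1 / ε⌉₊ then i + 1 else ⌈(rawThreshold ε i : ℝ) * (1 + ε)⌉₊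

/-- The threshold values `σ 1 < … < σ τ = Q`: the raw sequence as long as it is below `Q`, followed
by `Q`.  All later values are set to `Q + 1`, so that the last bucket `[σ τ, σ (τ + 1))` is `{Q}`. -/
noncomputable def threshold (ε : ℝ) (Q i : ℕ) : ℕ :=
  if rawThreshold ε i < Q then rawThreshold ε i
  else if rawThreshold ε (i - 1) < Q then Q else Q + 1

/-- The partial tour of `t` in the subtree rooted at `v` lies in the `i`-th bucket. -/
def Tour.InBucket {N : TreeNetwork V} (ε : ℝ) (v : V) (i : ℕ) (t : N.Tour) : Prop :=
  threshold ε N.capacity i ≤ t.coverage v ∧ t.coverage v < threshold ε N.capacity (i + 1)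

open Classical in
/-- The number of tours of `S` in the `i`-th bucket of `v`, counted with multiplicity. -/
noncomputable def bucketCount {N : TreeNetwork V} (ε : ℝ) (S : Multiset N.Tour) (v : V) (i : ℕ) :
    ℕ :=
  S.countP (Tour.InBucket ε v i)

/-- The `i`-th bucket of `v` is small: it has at most `α log³ n / ε²` tours. -/
def IsSmallBucket {N : TreeNetwork V} (α ε : ℝ) (S : Multiset N.Tour) (v : V) (i : ℕ) : Prop :=
  (bucketCount ε S v i : ℝ) ≤ α * Real.log (Fintype.card V) ^ 3 / ε ^ 2

/-- There are `g` group sizes `σ i ≤ h 1 ≤ … ≤ h g < σ (i + 1)` such that every tour in the `i`-th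
bucket of `v` has one of these sizes at `v`. -/
def HasGroupSizes {N : TreeNetwork V} (g : ℕ) (ε : ℝ) (S : Multiset N.Tour) (v : V) (i : ℕ) :
    Prop :=
  ∃ h : Fin g → ℕ, Monotone h ∧
    (∀ j, threshold ε N.capacity i ≤ h j ∧ h j < threshold ε N.capacity (i + 1)) ∧
    ∀ t ∈ S, Tour.InBucket ε v i t → ∃ j, t.coverage v = h j

end TreeNetwork

/-! Only the loads of the tours matter. The cheapest tour with load `x` crosses twice each edge
below which `x` has tokens, so its cost is `loadCost x` (`loadCost_le_cost`, `exists_tour`), and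
loads can be cut at a vertex and recombined freely.

The levels are treated from the deepest up to depth 1. At a vertex `v` of the current level, the
partial loads in a big bucket are sorted, cut into groups of `q`, and rounded up to the largest size
of their group by dummy tokens at `v`. A shift by `q` positions hands each partial load to a tour
whose former size at `v` was at least the rounded one, so old tours stay within capacity; the top
`q` partial loads go to extra tours (`exists_shift`, `exists_rearrangement`). Below `v` whole
partial loads are only permuted, so what was achieved deeper survives.

The extra tours are copies of a sample `R` of the current tours. Sizes in one bucket differ by a
factor of at most 2, so a sampled tour is replaced at each `v` by at most twice its own size. Over
the whole level this is at most `2Q`, which fits into three tours that go only where the sampled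
tour went (`exists_three_bins`, `exists_level`). Sampling with probability about `ε / (2H)`, `H` the
height, meets every big bucket in at least a `1/g` proportion (`exists_sample`). The three copies
raise the cost by a factor `1 + 8ε/(5H)` per level, hence by at most `1 + 99ε/25` in all
(`exists_rounding`).

The union bound behind the sampling needs a number of tours polynomial in `n` and `1/ε`. An exchange
argument leaves at most `n²` tours besides full loads at single vertices; the latter only have sizes
`0` and `Q` and are set aside (`exists_reduced_loads`). During the rounding, a small price per tour,
added to the cost, bounds the number of tours (`exists_tour_price`). At the depot all tours are
filled up to `Q` for free. -/

section

set_option linter.unusedSectionVars false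

open Finset

namespace TreeNetwork

/-! ### Subtrees, and the cost of a load. -/

section Tree

variable {V : Type*} [Fintype V] (N : TreeNetwork V)

/-- The number of edges on the path from the depot to `v`. -/
noncomputable def depth (v : V) : ℕ := N.graph.dist N.depot v

theorem mem_subtree {u v : V} :
    u ∈ N.subtree v ↔ ∀ p : N.graph.Walk N.depot u, v ∈ p.support := by
  simp [subtree]

theorem self_mem_subtree (v : V) : v ∈ N.subtree v :=
  N.mem_subtree.2 fun p => p.end_mem_support

theorem mem_subtree_depot (v : V) : v ∈ N.subtree N.depot :=
  N.mem_subtree.2 fun p => p.start_mem_support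

theorem subtree_depot : N.subtree N.depot = univ := by
  ext v; simp [N.mem_subtree_depot v]

theorem mem_subtree_trans {u v w : V} (huv : u ∈ N.subtree v) (hvw : v ∈ N.subtree w) :
    u ∈ N.subtree w := by
  rw [mem_subtree] at *
  intro p
  obtain ⟨q, r, rfl⟩ := SimpleGraph.Walk.mem_support_iff_exists_append.1 (huv p)
  rw [SimpleGraph.Walk.mem_support_append_iff]
  exact Or.inl (hvw q)

theorem exists_walk_length_eq_depth (v : V) :
    ∃ p : N.graph.Walk N.depot v, p.length = N.depth v :=
  N.isTree.connected.exists_walk_length_eq_dist _ _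

theorem depth_le_length {v : V} (p : N.graph.Walk N.depot v) : N.depth v ≤ p.length :=
  SimpleGraph.dist_le p

theorem depth_le_of_mem_subtree {u v : V} (h : u ∈ N.subtree v) : N.depth v ≤ N.depth u := by
  obtain ⟨p, hp⟩ := N.exists_walk_length_eq_depth u
  obtain ⟨q, r, rfl⟩ := SimpleGraph.Walk.mem_support_iff_exists_append.1 (N.mem_subtree.1 h p)
  have := N.depth_le_length q
  rw [SimpleGraph.Walk.length_append] at hp
  omega

theorem eq_of_mem_subtree_of_depth_eq {u v : V} (h : u ∈ N.subtree v)
    (hd : N.depth u = N.depth v) : u = v := by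
  obtain ⟨p, hp⟩ := N.exists_walk_length_eq_depth u
  obtain ⟨q, r, rfl⟩ := SimpleGraph.Walk.mem_support_iff_exists_append.1 (N.mem_subtree.1 h p)
  have := N.depth_le_length q
  rw [SimpleGraph.Walk.length_append] at hp
  exact (SimpleGraph.Walk.eq_of_length_eq_zero (p := r) (by omega)).symm

/-- A shortest walk to `u` passes through both `v` and `w`; if `v` came after `w` it would be
strictly deeper, unless they coincide. -/
theorem mem_subtree_of_common {u v w : V} (hv : u ∈ N.subtree v) (hw : u ∈ N.subtree w)
    (hd : N.depth v ≤ N.depth w) : w ∈ N.subtree v := by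
  rw [mem_subtree]
  intro q
  obtain ⟨p, hp⟩ := N.exists_walk_length_eq_depth u
  obtain ⟨p₁, e, rfl⟩ := SimpleGraph.Walk.mem_support_iff_exists_append.1 (N.mem_subtree.1 hw p)
  have hv' := N.mem_subtree.1 hv (q.append e)
  rw [SimpleGraph.Walk.mem_support_append_iff] at hv'
  rcases hv' with h | h
  · exact h
  · obtain ⟨d₁, d₂, rfl⟩ := SimpleGraph.Walk.mem_support_iff_exists_append.1 h
    obtain ⟨s, hs⟩ := N.exists_walk_length_eq_depth v
    have h1 := N.depth_le_length (s.append d₂)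
    have h2 := N.depth_le_length p₁
    simp only [SimpleGraph.Walk.length_append] at hp h1
    have : v = w := (SimpleGraph.Walk.eq_of_length_eq_zero (p := d₁) (by omega)).symm
    subst this
    exact q.end_mem_support

theorem disjoint_subtree {v w : V} (hne : v ≠ w) (hd : N.depth v = N.depth w) :
    Disjoint (N.subtree v) (N.subtree w) := by
  rw [Finset.disjoint_left]
  intro u hv hw
  exact hne (N.eq_of_mem_subtree_of_depth_eq (N.mem_subtree_of_common hv hw hd.le) hd.symm).symm

theorem depth_depot : N.depth N.depot = 0 := by simp [depth]

theorem depth_eq_zero {v : V} : N.depth v = 0 ↔ v = N.depot := by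
  rw [depth, (N.isTree.connected).dist_eq_zero_iff, eq_comm]

/-- The first edge of a shortest walk from `v` to the depot is a bridge. The rest of that walk
cannot return to `v`, so it avoids the edge, and every walk from the depot to `v` must use it. -/
theorem exists_parent {v : V} (hv : v ≠ N.depot) :
    ∃ a, N.graph.Adj a v ∧ N.depth a + 1 = N.depth v ∧
      ∀ q : N.graph.Walk N.depot v, s(a, v) ∈ q.edges := by
  obtain ⟨p, hp⟩ := N.exists_walk_length_eq_depth v
  obtain ⟨p', hp'⟩ : ∃ p' : N.graph.Walk v N.depot, p'.length = N.depth v := ⟨p.reverse, by simpa⟩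
  cases p' with
  | nil => exact absurd rfl hv
  | @cons _ a _ h q =>
    rw [SimpleGraph.Walk.length_cons] at hp'
    have hle : N.depth v ≤ N.depth a + 1 := by
      obtain ⟨s, hs⟩ := N.exists_walk_length_eq_depth a
      have := N.depth_le_length (s.concat h.symm)
      rw [SimpleGraph.Walk.length_concat] at this
      omega
    have hqa : N.depth a ≤ q.length := by simpa using N.depth_le_length q.reverse
    refine ⟨a, h.symm, by omega, fun r => ?_⟩
    have hb := SimpleGraph.isAcyclic_iff_forall_adj_isBridge.1 N.isTree.isAcyclic h.symm
    have hm := SimpleGraph.isBridge_iff_forall_walk_mem_edges.1 hb (q.append r)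
    rw [SimpleGraph.Walk.edges_append, List.mem_append] at hm
    refine hm.resolve_left fun hq => ?_
    have hvs := SimpleGraph.Walk.snd_mem_support_of_mem_edges _ hq
    obtain ⟨q₁, q₂, rfl⟩ := SimpleGraph.Walk.mem_support_iff_exists_append.1 hvs
    have := N.depth_le_length q₂.reverse
    rw [SimpleGraph.Walk.length_append] at hp'
    rw [SimpleGraph.Walk.length_reverse] at this
    omega

open Classical in
/-- The parent of a vertex; the depot is its own parent. -/
noncomputable def parent (v : V) : V :=
  if h : v ≠ N.depot then (N.exists_parent h).choose else v

theorem parent_spec {v : V} (h : v ≠ N.depot) :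
    N.graph.Adj (N.parent v) v ∧ N.depth (N.parent v) + 1 = N.depth v ∧
      ∀ q : N.graph.Walk N.depot v, s(N.parent v, v) ∈ q.edges := by
  rw [parent, dif_pos h]
  exact (N.exists_parent h).choose_spec

theorem mem_subtree_parent (v : V) : v ∈ N.subtree (N.parent v) := by
  by_cases h : v ≠ N.depot
  · exact N.mem_subtree.2 fun q =>
      SimpleGraph.Walk.fst_mem_support_of_mem_edges _ ((N.parent_spec h).2.2 q)
  · rw [parent, dif_neg h]
    exact N.self_mem_subtree v

theorem exists_ancestor {u : V} {l : ℕ} (hl : l ≤ N.depth u) :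
    ∃ v, N.depth v = l ∧ u ∈ N.subtree v := by
  obtain ⟨k, hk⟩ := Nat.exists_eq_add_of_le hl
  induction k generalizing u with
  | zero => exact ⟨u, by omega, N.self_mem_subtree u⟩
  | succ k ih =>
    have hu : u ≠ N.depot := by
      rw [Ne, ← N.depth_eq_zero]; omega
    have hp := (N.parent_spec hu).2.1
    obtain ⟨v, hv, huv⟩ := ih (u := N.parent u) (by omega) (by omega)
    exact ⟨v, hv, N.mem_subtree_trans (N.mem_subtree_parent u) huv⟩

/-- The number of tokens that the load `x` has in the subtree rooted at `v`. -/
noncomputable def cov (x : V → ℕ) (v : V) : ℕ := ∑ u ∈ N.subtree v, x u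

theorem cov_pos_iff {x : V → ℕ} {v : V} : 0 < N.cov x v ↔ ∃ u ∈ N.subtree v, 0 < x u := by
  rw [cov, Finset.sum_pos_iff]

theorem cov_le_sum (x : V → ℕ) (v : V) : N.cov x v ≤ ∑ u, x u :=
  Finset.sum_le_sum_of_subset (Finset.subset_univ _)

theorem cov_depot (x : V → ℕ) : N.cov x N.depot = ∑ u, x u := by
  rw [cov, subtree_depot]

/-- The cost of going from the parent of `v` to `v` and back. -/
noncomputable def edgeCost (v : V) : ℕ := by
  classical exact if v = N.depot then 0 else 2 * N.weight s(N.parent v, v)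

theorem edgeCost_depot : N.edgeCost N.depot = 0 := by simp [edgeCost]

/-- The cost of a cheapest closed walk from the depot to all the vertices at which `x` has
tokens. -/
noncomputable def loadCost (x : V → ℕ) : ℕ := ∑ v, if 0 < N.cov x v then N.edgeCost v else 0

theorem loadCost_mono {x y : V → ℕ} (h : ∀ v, v ≠ N.depot → 0 < N.cov x v → 0 < N.cov y v) :
    N.loadCost x ≤ N.loadCost y := by
  refine Finset.sum_le_sum fun v _ => ?_
  by_cases hv : v = N.depot
  · simp [hv, edgeCost_depot]
  · split_ifs with h1 h2 h2
    · exact le_rfl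
    · exact absurd (h v hv h1) h2
    · exact Nat.zero_le _
    · exact le_rfl

theorem loadCost_mono_support {x y : V → ℕ} (h : ∀ v, x v ≠ 0 → y v ≠ 0) :
    N.loadCost x ≤ N.loadCost y := by
  refine N.loadCost_mono fun v _ hv => ?_
  rw [cov_pos_iff] at *
  obtain ⟨u, hu, hx⟩ := hv
  exact ⟨u, hu, Nat.pos_of_ne_zero (h u hx.ne')⟩

theorem parentEdge_injective {u v : V} (hu : u ≠ N.depot) (hv : v ≠ N.depot)
    (h : s(N.parent u, u) = s(N.parent v, v)) : u = v := by
  rw [Sym2.eq_iff] at h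
  rcases h with h | ⟨h1, h2⟩
  · exact h.2
  · have hu := (N.parent_spec hu).2.1
    have hv := (N.parent_spec hv).2.1
    rw [h1] at hu
    rw [← h2] at hv
    omega

/-- A token below `v` forces the route to cross the parent edge of `v` once before and once after
visiting the token, and different vertices have different parent edges. -/
theorem loadCost_le_cost (t : N.Tour) : N.loadCost t.load ≤ t.cost := by
  classical
  rw [Tour.cost, Finset.sum_list_map_count]
  set A : Finset V := univ.filter fun v => v ≠ N.depot ∧ 0 < N.cov t.load v with hA
  have hcount : ∀ v ∈ A, 2 ≤ t.route.edges.count s(N.parent v, v) := by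
    intro v hv
    simp only [hA, mem_filter, mem_univ, true_and] at hv
    obtain ⟨hv, hc⟩ := hv
    obtain ⟨u, hu, hx⟩ := N.cov_pos_iff.1 hc
    have hs := t.visits u hx.ne'
    obtain ⟨q, r, hqr⟩ := SimpleGraph.Walk.mem_support_iff_exists_append.1 hs
    have key : ∀ q : N.graph.Walk N.depot u, s(N.parent v, v) ∈ q.edges := by
      intro q
      obtain ⟨q₁, q₂, rfl⟩ :=
        SimpleGraph.Walk.mem_support_iff_exists_append.1 (N.mem_subtree.1 hu q)
      rw [SimpleGraph.Walk.edges_append, List.mem_append]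
      exact Or.inl ((N.parent_spec hv).2.2 q₁)
    have h1 := List.count_pos_iff.2 (key q)
    have h2 := key r.reverse
    rw [SimpleGraph.Walk.edges_reverse, List.mem_reverse] at h2
    have h2 := List.count_pos_iff.2 h2
    rw [hqr, SimpleGraph.Walk.edges_append, List.count_append]
    omega
  calc N.loadCost t.load = ∑ v ∈ A, 2 * N.weight s(N.parent v, v) := by
        rw [loadCost, hA, Finset.sum_filter]
        refine Finset.sum_congr rfl fun v _ => ?_
        by_cases hv : v = N.depot <;> simp [edgeCost, hv]
    _ ≤ ∑ v ∈ A, t.route.edges.count s(N.parent v, v) • N.weight s(N.parent v, v) :=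
        Finset.sum_le_sum fun v hv => by
          rw [smul_eq_mul]; exact Nat.mul_le_mul_right _ (hcount v hv)
    _ = ∑ e ∈ A.image fun v => s(N.parent v, v), t.route.edges.count e • N.weight e := by
        rw [Finset.sum_image]
        intro u hu v hv h
        simp only [hA, coe_filter, mem_univ, true_and, Set.mem_ofPred_eq] at hu hv
        exact N.parentEdge_injective hu.1 hv.1 h
    _ ≤ _ := by
        refine Finset.sum_le_sum_of_subset fun e he => ?_
        obtain ⟨v, hv, rfl⟩ := Finset.mem_image.1 he
        have := hcount v hv
        exact List.mem_toFinset.2 (List.count_pos_iff.1 (by omega))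

/-- Induction on the size of `A`: a deepest vertex is the parent of no other vertex of `A`, so it
can be removed and put back as a detour from its parent. -/
theorem exists_closed_walk (k : ℕ) (A : Finset V) (hk : A.card = k) (hr : N.depot ∈ A)
    (hA : ∀ v ∈ A, N.parent v ∈ A) :
    ∃ p : N.graph.Walk N.depot N.depot, (∀ v ∈ A, v ∈ p.support) ∧
      (p.edges.map N.weight).sum = ∑ v ∈ A, N.edgeCost v := by
  classical
  induction k generalizing A with
  | zero => simp_all
  | succ k ih =>
    obtain ⟨v, hvA, hmax⟩ := A.exists_max_image N.depth ⟨_, hr⟩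
    by_cases hv : v = N.depot
    · have : A = {N.depot} := by
        ext u
        rw [mem_singleton]
        refine ⟨fun hu => ?_, fun hu => hu ▸ hr⟩
        have := hmax u hu
        rw [hv, depth_depot, Nat.le_zero, depth_eq_zero] at this
        exact this
      subst this
      exact ⟨.nil, by simp, by simp [edgeCost_depot]⟩
    · have hsp := N.parent_spec hv
      have hmem : ∀ u ∈ A, u ≠ v → N.parent u ∈ A.erase v := by
        intro u hu huv
        refine Finset.mem_erase.2 ⟨fun h => ?_, hA u hu⟩
        by_cases hur : u = N.depot
        · rw [parent, dif_neg (by simpa using hur)] at h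
          exact huv h
        · have h1 := (N.parent_spec hur).2.1
          have h2 := hmax u hu
          rw [h] at h1
          omega
      obtain ⟨p, hp, hpc⟩ := ih (A.erase v) (by rw [card_erase_of_mem hvA, hk]; rfl)
        (mem_erase.2 ⟨Ne.symm hv, hr⟩)
        (fun u hu => hmem u (mem_of_mem_erase hu) (ne_of_mem_erase hu))
      have hpar : N.parent v ∈ p.support :=
        hp _ (mem_erase.2 ⟨hsp.1.ne, hA v hvA⟩)
      obtain ⟨q, r, rfl⟩ := SimpleGraph.Walk.mem_support_iff_exists_append.1 hpar
      refine ⟨q.append (.cons hsp.1 (.cons hsp.1.symm r)), fun u hu => ?_, ?_⟩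
      · by_cases huv : u = v
        · subst huv; simp [SimpleGraph.Walk.mem_support_append_iff]
        · have := hp u (mem_erase.2 ⟨huv, hu⟩)
          rw [SimpleGraph.Walk.mem_support_append_iff] at this ⊢
          rcases this with h | h
          · exact Or.inl h
          · right; simp [h]
      · rw [← Finset.add_sum_erase _ _ hvA, ← hpc, edgeCost, if_neg hv]
        simp only [SimpleGraph.Walk.edges_append, SimpleGraph.Walk.edges_cons, List.map_append,
          List.map_cons, List.sum_append, List.sum_cons]
        rw [Sym2.eq_swap (a := v)]
        omega

theorem exists_tour (x : V → ℕ) (hx : ∑ v, x v ≤ N.capacity) :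
    ∃ t : N.Tour, t.load = x ∧ t.cost = N.loadCost x := by
  classical
  set A : Finset V := insert N.depot (univ.filter fun v => 0 < N.cov x v) with hAdef
  have hA : ∀ v ∈ A, N.parent v ∈ A := by
    intro v hv
    rw [hAdef, mem_insert, mem_filter] at hv ⊢
    rcases hv with rfl | hv
    · left; simp [parent]
    · right
      refine ⟨mem_univ _, ?_⟩
      obtain ⟨u, hu, h⟩ := N.cov_pos_iff.1 hv.2
      exact N.cov_pos_iff.2 ⟨u, N.mem_subtree_trans hu (N.mem_subtree_parent v), h⟩
  obtain ⟨p, hp, hc⟩ := N.exists_closed_walk _ A rfl (mem_insert_self _ _) hA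
  refine ⟨⟨p, x, fun v hv => hp v (mem_insert_of_mem (mem_filter.2 ⟨mem_univ _, ?_⟩)), hx⟩, rfl, ?_⟩
  · exact N.cov_pos_iff.2 ⟨v, N.self_mem_subtree v, Nat.pos_of_ne_zero hv⟩
  · rw [Tour.cost, hc, loadCost, ← Finset.sum_filter, hAdef]
    by_cases h : N.depot ∈ univ.filter fun v => 0 < N.cov x v
    · rw [insert_eq_of_mem h]
    · rw [sum_insert h, edgeCost_depot, zero_add]

end Tree

/-! ### Thresholds and buckets. -/

section Threshold

variable {ε : ℝ}

theorem one_le_ceil_inv (hε : 0 < ε) : 1 ≤ ⌈1 / ε⌉₊ :=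
  Nat.one_le_ceil_iff.2 (by positivity)

theorem rawThreshold_eq_self : ∀ {i : ℕ}, i ≤ ⌈1 / ε⌉₊ → rawThreshold ε i = i
  | 0, _ => by rw [rawThreshold]
  | i + 1, h => by rw [rawThreshold, if_pos h]

theorem rawThreshold_succ_of_lt {i : ℕ} (h : ⌈1 / ε⌉₊ < i + 1) :
    rawThreshold ε (i + 1) = ⌈(rawThreshold ε i : ℝ) * (1 + ε)⌉₊ := by
  rw [rawThreshold, if_neg (by omega)]

/-- The first bound makes the value positive, so that multiplying by `1 + ε` and rounding up is a
strict increase; this in turn carries the first bound on. -/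
theorem self_le_rawThreshold (hε : 0 < ε) (i : ℕ) :
    i ≤ rawThreshold ε i ∧ rawThreshold ε i < rawThreshold ε (i + 1) := by
  have key : ∀ i, i ≤ rawThreshold ε i → rawThreshold ε i < rawThreshold ε (i + 1) := by
    intro i hi
    by_cases h : i + 1 ≤ ⌈1 / ε⌉₊
    · rw [rawThreshold_eq_self h, rawThreshold_eq_self (by omega)]; omega
    · rw [rawThreshold_succ_of_lt (by omega), Nat.lt_ceil]
      have h1 := one_le_ceil_inv hε
      have : (0 : ℝ) < rawThreshold ε i := by exact_mod_cast (by omega : 0 < rawThreshold ε i)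
      nlinarith
  have : i ≤ rawThreshold ε i := by
    induction i with
    | zero => exact Nat.zero_le _
    | succ i ih => have := key i ih; omega
  exact ⟨this, key i this⟩

theorem rawThreshold_strictMono (hε : 0 < ε) : StrictMono (rawThreshold ε) :=
  strictMono_nat_of_lt_succ fun i => (self_le_rawThreshold hε i).2

theorem threshold_zero (Q : ℕ) (hQ : 0 < Q) : threshold ε Q 0 = 0 := by
  simp [threshold, rawThreshold, hQ]

theorem threshold_le_succ (hε : 0 < ε) (Q i : ℕ) : threshold ε Q i ≤ threshold ε Q (i + 1) := by
  have h1 := (self_le_rawThreshold hε i).2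
  have h2 : rawThreshold ε (i - 1) ≤ rawThreshold ε i :=
    (rawThreshold_strictMono hε).monotone (Nat.sub_le _ _)
  simp only [threshold, Nat.add_sub_cancel]
  split_ifs <;> omega

theorem threshold_mono (hε : 0 < ε) (Q : ℕ) : Monotone (threshold ε Q) :=
  monotone_nat_of_le_succ (threshold_le_succ hε Q)

theorem le_of_threshold_le (hε : 0 < ε) {Q i : ℕ} (h : threshold ε Q i ≤ Q) (hi : 1 ≤ i) :
    rawThreshold ε (i - 1) < Q := by
  have h1 := (self_le_rawThreshold hε (i - 1)).2
  rw [Nat.sub_add_cancel hi] at h1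
  by_contra hc
  rw [threshold, if_neg (by omega), if_neg hc] at h
  omega

theorem lt_threshold (hε : 0 < ε) {Q i : ℕ} (hi : Q + 1 ≤ i) : Q < threshold ε Q i := by
  by_contra hc
  have h1 := le_of_threshold_le hε (not_lt.1 hc) (by omega)
  have h2 := (self_le_rawThreshold hε (i - 1)).1
  omega

/-- The size `a` belongs to the `i`-th bucket. -/
def InBucketSize (ε : ℝ) (Q i a : ℕ) : Prop :=
  threshold ε Q i ≤ a ∧ a < threshold ε Q (i + 1)

/-- The index of the bucket to which the size `a` belongs. -/
noncomputable def bucketIndex (ε : ℝ) (Q a : ℕ) : ℕ :=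
  Nat.findGreatest (fun i => threshold ε Q i ≤ a) (Q + 1)

theorem inBucketSize_bucketIndex (hε : 0 < ε) {Q a : ℕ} (hQ : 0 < Q) (ha : a ≤ Q) :
    InBucketSize ε Q (bucketIndex ε Q a) a := by
  have h0 : threshold ε Q 0 ≤ a := by rw [threshold_zero Q hQ]; exact Nat.zero_le _
  have h1 : threshold ε Q (bucketIndex ε Q a) ≤ a :=
    Nat.findGreatest_spec (P := fun i => threshold ε Q i ≤ a) (Nat.zero_le (Q + 1)) h0
  refine ⟨h1, ?_⟩
  by_contra hc
  have hle : bucketIndex ε Q a + 1 ≤ Q + 1 := by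
    by_contra hcc
    have := lt_threshold hε (Q := Q) (i := bucketIndex ε Q a) (by omega)
    omega
  exact Nat.findGreatest_is_greatest (P := fun i => threshold ε Q i ≤ a)
    (Nat.lt_succ_self _) hle (not_lt.1 hc)

theorem InBucketSize.unique (hε : 0 < ε) {Q i j a : ℕ} (hi : InBucketSize ε Q i a)
    (hj : InBucketSize ε Q j a) : i = j := by
  rcases lt_trichotomy i j with h | h | h
  · have := threshold_mono hε Q (show i + 1 ≤ j from h)
    have := hi.2; have := hj.1; omega
  · exact h
  · have := threshold_mono hε Q (show j + 1 ≤ i from h)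
    have := hj.2; have := hi.1; omega

theorem inBucketSize_iff (hε : 0 < ε) {Q i a : ℕ} (hQ : 0 < Q) (ha : a ≤ Q) :
    InBucketSize ε Q i a ↔ bucketIndex ε Q a = i := by
  have h := inBucketSize_bucketIndex hε hQ ha
  exact ⟨fun hi => h.unique hε hi, fun hi => hi ▸ h⟩

theorem bucketIndex_eq_zero_iff (hε : 0 < ε) {Q a : ℕ} (hQ : 0 < Q) (ha : a ≤ Q) :
    bucketIndex ε Q a = 0 ↔ a = 0 := by
  have h1 : threshold ε Q 1 = 1 := by
    have := one_le_ceil_inv hε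
    simp only [threshold, rawThreshold_eq_self this, Nat.sub_self, rawThreshold_eq_self zero_le]
    split_ifs <;> omega
  rw [← inBucketSize_iff hε hQ ha, InBucketSize, threshold_zero Q hQ, zero_add, h1]
  omega

theorem InBucketSize.eq_capacity {Q i a : ℕ} (hQ : InBucketSize ε Q i Q)
    (ha : InBucketSize ε Q i a) (haQ : a ≤ Q) : a = Q := by
  have h2 := hQ.2
  have h1 := ha.1
  simp only [threshold, Nat.add_sub_cancel] at h1 h2
  split_ifs at h1 h2 <;> omega

/-- Since `σ (i+1) ≤ 2 σ i + 1` and the upper end is excluded, the factor 2 comes without additive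
error. It bounds what an extra tour has to take over. -/
theorem InBucketSize.le_two_mul (hε : 0 < ε) (hε1 : ε < 1) {Q i a b : ℕ}
    (ha : InBucketSize ε Q i a) (haQ : a ≤ Q) (hb : InBucketSize ε Q i b) : a ≤ 2 * b := by
  have h1 := hb.1
  have h2 := ha.2
  by_cases h : rawThreshold ε i < Q
  · have h3 : threshold ε Q (i + 1) ≤ rawThreshold ε (i + 1) := by
      have := (self_le_rawThreshold hε i).2
      simp only [threshold, Nat.add_sub_cancel]
      split_ifs <;> omega
    have h4 : threshold ε Q i = rawThreshold ε i := by rw [threshold, if_pos h]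
    have h5 : rawThreshold ε (i + 1) ≤ 2 * rawThreshold ε i + 1 := by
      by_cases hi : i + 1 ≤ ⌈1 / ε⌉₊
      · rw [rawThreshold_eq_self hi, rawThreshold_eq_self (by omega)]; omega
      · rw [rawThreshold_succ_of_lt (by omega), Nat.ceil_le]
        push_cast
        have : (0 : ℝ) ≤ rawThreshold ε i := Nat.cast_nonneg _
        nlinarith
    omega
  · have : Q ≤ threshold ε Q i := by
      rw [threshold, if_neg h]; split_ifs <;> omega
    omega

theorem rawThreshold_lower (hε : 0 < ε) (k : ℕ) :
    (1 + ε) ^ k ≤ (rawThreshold ε (⌈1 / ε⌉₊ + k) : ℝ) := by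
  induction k with
  | zero =>
    rw [add_zero, rawThreshold_eq_self le_rfl, pow_zero]
    exact_mod_cast one_le_ceil_inv hε
  | succ k ih =>
    rw [← add_assoc, rawThreshold_succ_of_lt (by omega), pow_succ]
    exact (mul_le_mul_of_nonneg_right ih (by positivity)).trans (Nat.le_ceil _)

/-- About `1/ε` thresholds grow by one; after them each step gains a factor `1 + ε`, whose logarithm
is at least `ε/2`. -/
theorem bucketIndex_le (hε : 0 < ε) (hε1 : ε < 1) {Q a : ℕ} (hQ : 0 < Q) (ha : a ≤ Q) :
    (bucketIndex ε Q a : ℝ) ≤ 2 + 1 / ε + 2 * Real.log Q / ε := by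
  have hlogQ : 0 ≤ Real.log Q := Real.log_natCast_nonneg Q
  have hnn : 0 ≤ 2 * Real.log Q / ε := by positivity
  have h1ε : 0 ≤ 1 / ε := by positivity
  rcases Nat.eq_zero_or_pos (bucketIndex ε Q a) with h0 | hpos
  · rw [h0]; push_cast; linarith
  obtain ⟨h, -⟩ := inBucketSize_bucketIndex hε hQ ha
  have hlt := le_of_threshold_le hε (h.trans ha) hpos
  set j := bucketIndex ε Q a - 1 with hj
  have hij : bucketIndex ε Q a = j + 1 := by omega
  rw [hij]
  have hc : (⌈1 / ε⌉₊ : ℝ) < 1 / ε + 1 := Nat.ceil_lt_add_one h1ε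
  push_cast
  rcases le_total j ⌈1 / ε⌉₊ with hjc | hjc
  · have : (j : ℝ) ≤ ⌈1 / ε⌉₊ := by exact_mod_cast hjc
    linarith
  · obtain ⟨k, hk⟩ := Nat.exists_eq_add_of_le hjc
    have hlow := rawThreshold_lower hε k
    rw [← hk] at hlow
    have hQ' : (rawThreshold ε j : ℝ) ≤ Q := by exact_mod_cast hlt.le
    have hlog : (k : ℝ) * Real.log (1 + ε) ≤ Real.log Q := by
      rw [← Real.log_pow]
      exact Real.log_le_log (by positivity) (hlow.trans hQ')
    have hl : ε / 2 ≤ Real.log (1 + ε) := by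
      refine le_trans ?_ (Real.one_sub_inv_le_log_of_pos (by positivity))
      have : 1 - (1 + ε)⁻¹ = ε / (1 + ε) := by field_simp; ring
      rw [this]
      exact div_le_div_of_nonneg_left hε.le (by positivity) (by linarith)
    have hk2 : (k : ℝ) ≤ 2 * Real.log Q / ε := by
      rw [le_div_iff₀ hε]
      have : (0 : ℝ) ≤ k := Nat.cast_nonneg k
      nlinarith
    rw [hk]; push_cast; linarith

end Threshold

/-! ### Random sampling, as finite weighted sums. -/

section Sampling

variable {ι : Type*} [Fintype ι] [DecidableEq ι]

/-- The probability of the outcome `R` when each element is chosen independently with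
probability `p`. -/
noncomputable def sampleWeight (p : ℝ) (R : Finset ι) : ℝ :=
  (∏ _t ∈ R, p) * ∏ _t ∈ univ \ R, (1 - p)

/-- Independence: the expectation of a product is the product of the expectations. All other
expectations needed are reduced to this one. -/
theorem sum_sampleWeight_mul_prod (p : ℝ) (f g : ι → ℝ) :
    ∑ R ∈ (univ : Finset ι).powerset, sampleWeight p R * ∏ t, (if t ∈ R then f t else g t) =
      ∏ t, (p * f t + (1 - p) * g t) := by
  rw [Finset.prod_add]
  refine Finset.sum_congr rfl fun R hR => ?_
  have hR : R ⊆ univ := Finset.subset_univ R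
  rw [sampleWeight, ← Finset.prod_sdiff hR, Finset.prod_mul_distrib, Finset.prod_mul_distrib]
  have h1 : ∏ t ∈ R, (if t ∈ R then f t else g t) = ∏ t ∈ R, f t :=
    Finset.prod_congr rfl fun t ht => if_pos ht
  have h2 : ∏ t ∈ univ \ R, (if t ∈ R then f t else g t) = ∏ t ∈ univ \ R, g t :=
    Finset.prod_congr rfl fun t ht => if_neg (Finset.mem_sdiff.1 ht).2
  rw [h1, h2]
  ring

theorem sum_sampleWeight (p : ℝ) :
    ∑ R ∈ (univ : Finset ι).powerset, sampleWeight p R = 1 := by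
  simpa using sum_sampleWeight_mul_prod (ι := ι) p (fun _ => 1) (fun _ => 1)

theorem sum_sampleWeight_mem (p : ℝ) (t : ι) :
    ∑ R ∈ (univ : Finset ι).powerset, sampleWeight p R * (if t ∈ R then 1 else 0) = p := by
  have h := sum_sampleWeight_mul_prod (ι := ι) p (fun _ => 1) (fun s => if s = t then 0 else 1)
  have h1 : ∀ R : Finset ι, ∏ s, (if s ∈ R then (1 : ℝ) else if s = t then 0 else 1) =
      if t ∈ R then 1 else 0 := by
    intro R
    split_ifs with ht
    · refine Finset.prod_eq_one fun s _ => ?_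
      split_ifs with h1 h2
      · rfl
      · exact absurd (h2 ▸ ht) h1
      · rfl
    · exact Finset.prod_eq_zero (mem_univ t) (by simp [ht])
  simp only [h1] at h
  rw [h, Finset.prod_eq_single t]
  · simp
  · intro s _ hs; simp [hs]
  · simp

theorem sum_sampleWeight_sum (p : ℝ) (w : ι → ℝ) :
    ∑ R ∈ (univ : Finset ι).powerset, sampleWeight p R * ∑ t ∈ R, w t = p * ∑ t, w t := by
  have h1 : ∀ R : Finset ι, sampleWeight p R * ∑ t ∈ R, w t =
      ∑ t, sampleWeight p R * (if t ∈ R then 1 else 0) * w t := by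
    intro R
    rw [Finset.mul_sum, ← Finset.sum_filter_add_sum_filter_not univ (· ∈ R)]
    simp only [Finset.filter_mem_eq_inter, univ_inter]
    rw [Finset.sum_congr rfl (fun t ht => by rw [if_pos ht, mul_one] : ∀ t ∈ R,
      sampleWeight p R * (if t ∈ R then 1 else 0) * w t = sampleWeight p R * w t)]
    rw [Finset.sum_eq_zero (s := univ.filter (· ∉ R))
      (fun t ht => by simp [(Finset.mem_filter.1 ht).2]), add_zero]
  simp only [h1]
  rw [Finset.sum_comm, Finset.mul_sum]
  refine Finset.sum_congr rfl fun t _ => ?_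
  rw [← Finset.sum_mul, sum_sampleWeight_mem]

theorem exp_neg_one_twentieth_le : Real.exp (-(1 / 20)) ≤ 1 - 39 / 800 := by
  have h := Real.quadratic_le_exp_of_nonneg (show (0 : ℝ) ≤ 1 / 20 by norm_num)
  rw [Real.exp_neg, inv_le_comm₀ (Real.exp_pos _) (by norm_num)]
  refine le_trans ?_ h
  norm_num

/-- Each element of `A` contributes the factor `1 - p (1 - exp (-1/20)) ≤ 1 - 39p/800 ≤ exp
(-39p/800)`. -/
theorem sum_sampleWeight_exp {p : ℝ} (hp : 0 ≤ p) (hp1 : p ≤ 1) (A : Finset ι) :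
    ∑ R ∈ (univ : Finset ι).powerset, sampleWeight p R *
        Real.exp (-(1 / 20) * (R ∩ A).card) ≤ Real.exp (-(39 / 800) * p * A.card) := by
  have h := sum_sampleWeight_mul_prod (ι := ι) p
    (fun t => if t ∈ A then Real.exp (-(1 / 20)) else 1) (fun _ => 1)
  have h1 : ∀ R : Finset ι, ∏ t, (if t ∈ R then if t ∈ A then Real.exp (-(1 / 20)) else 1 else 1)
      = Real.exp (-(1 / 20) * (R ∩ A).card) := by
    intro R
    simp only [← ite_and, ← Finset.mem_inter]
    rw [Finset.prod_ite, Finset.prod_const, Finset.prod_const_one, mul_one, ← Real.exp_nat_mul,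
      Finset.filter_mem_eq_inter, univ_inter, mul_comm]
  simp only [h1] at h
  rw [h]
  calc ∏ t, (p * (if t ∈ A then Real.exp (-(1 / 20)) else 1) + (1 - p) * 1)
      ≤ ∏ t, (if t ∈ A then Real.exp (-(39 / 800) * p) else 1) := by
        refine Finset.prod_le_prod (fun t _ => ?_) fun t _ => ?_
        · split_ifs
          · have h2 := exp_neg_one_twentieth_le
            have h3 := Real.exp_pos (-(1 / 20))
            have := mul_nonneg hp h3.le
            linarith
          · linarith
        · split_ifs
          · have h2 := exp_neg_one_twentieth_le
            have h4 := Real.add_one_le_exp (-(39 / 800) * p)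
            have := mul_le_mul_of_nonneg_left h2 hp
            linarith
          · linarith
    _ = Real.exp (-(39 / 800) * p * A.card) := by
        rw [Finset.prod_ite, Finset.prod_const, Finset.prod_const_one, mul_one, ← Real.exp_nat_mul,
          Finset.filter_mem_eq_inter, univ_inter, mul_comm]

/-- A random sample has small weight and meets all the large sets of a family in about the
expected proportion. -/
theorem exists_sample {κ : Type*} (J : Finset κ) (A : κ → Finset ι) (w : ι → ℝ) (hw : ∀ t, 0 ≤ w t)
    {p L η : ℝ} (hp : 0 < p) (hp1 : p < 1) (hη : η < 1) (hA : ∀ j ∈ J, L ≤ (A j).card)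
    (hJ : 2 * J.card * Real.exp (-(1 / 800) * p * L) ≤ η) :
    ∃ R : Finset ι, ∑ t ∈ R, w t ≤ (1 + η) * p * ∑ t, w t ∧
      ∀ j ∈ J, 19 / 20 * p * (A j).card ≤ (R ∩ A j).card := by
  set W := ∑ t, w t with hW
  have hW0 : 0 ≤ W := Finset.sum_nonneg fun t _ => hw t
  -- Relative weight plus one penalty per `j`. As `19/400 = 1/20 · 19/20`, the penalty is at least 2
  -- whenever `R` misses the required proportion of `A j`. The mean of `F` is at most `1 + η < 2`,
  -- the exponent `39/800 - 19/400 = 1/800` being left over, so an `R` with `F R ≤ 1 + η` satisfies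
  -- everything at once.
  set F : Finset ι → ℝ := fun R => (∑ t ∈ R, w t) / (p * W) +
    ∑ j ∈ J, 2 * Real.exp (19 / 400 * p * (A j).card) * Real.exp (-(1 / 20) * (R ∩ A j).card)
    with hF
  have hE : ∑ R ∈ (univ : Finset ι).powerset, sampleWeight p R * F R ≤
      ∑ R ∈ (univ : Finset ι).powerset, sampleWeight p R * (1 + η) := by
    rw [← Finset.sum_mul, sum_sampleWeight, one_mul]
    simp only [hF, mul_add, Finset.sum_add_distrib]
    refine add_le_add ?_ ?_
    · simp only [← mul_div_assoc]
      rw [← Finset.sum_div, sum_sampleWeight_sum]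
      exact div_self_le_one _
    · simp only [Finset.mul_sum]
      rw [Finset.sum_comm]
      refine le_trans (Finset.sum_le_card_nsmul J _ (2 * Real.exp (-(1 / 800) * p * L))
        fun j hj => ?_) (by rw [nsmul_eq_mul]; linarith)
      have h1 := sum_sampleWeight_exp hp.le hp1.le (A j)
      calc _ = 2 * Real.exp (19 / 400 * p * (A j).card) *
            ∑ R ∈ (univ : Finset ι).powerset, sampleWeight p R *
              Real.exp (-(1 / 20) * (R ∩ A j).card) := by
            rw [Finset.mul_sum]; exact Finset.sum_congr rfl fun R _ => by ring
        _ ≤ 2 * Real.exp (19 / 400 * p * (A j).card) *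
            Real.exp (-(39 / 800) * p * (A j).card) :=
            mul_le_mul_of_nonneg_left h1 (by positivity)
        _ = 2 * Real.exp (-(1 / 800) * p * (A j).card) := by
            rw [mul_assoc, ← Real.exp_add]; congr 2; ring
        _ ≤ _ := by
            refine mul_le_mul_of_nonneg_left (Real.exp_le_exp.2 ?_) (by norm_num)
            have := mul_le_mul_of_nonneg_left (hA j hj) hp.le
            linarith
  obtain ⟨R, -, hR⟩ := Finset.exists_le_of_sum_le ⟨∅, Finset.empty_mem_powerset _⟩ hE
  have hpos : 0 < sampleWeight p R :=
    mul_pos (Finset.prod_pos fun _ _ => hp) (Finset.prod_pos fun _ _ => by linarith)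
  have hFR : F R ≤ 1 + η := le_of_mul_le_mul_left hR hpos
  have hcost : 0 ≤ ∑ t ∈ R, w t := Finset.sum_nonneg fun t _ => hw t
  have hbad : ∀ j ∈ J, 0 ≤ 2 * Real.exp (19 / 400 * p * (A j).card) *
      Real.exp (-(1 / 20) * (R ∩ A j).card) := fun j _ => by positivity
  have hbad' := Finset.sum_nonneg hbad
  refine ⟨R, ?_, fun j hj => ?_⟩
  · rcases hW0.eq_or_lt with h0 | h0
    · have : ∑ t ∈ R, w t ≤ W :=
        Finset.sum_le_sum_of_subset_of_nonneg (subset_univ R) fun t _ _ => hw t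
      rw [← h0] at this ⊢
      linarith
    · have : (∑ t ∈ R, w t) / (p * W) ≤ 1 + η := by
        simp only [hF] at hFR; linarith
      rw [div_le_iff₀ (by positivity)] at this
      linarith
  · by_contra hcon
    push Not at hcon
    have h1 := Finset.single_le_sum hbad hj
    have h2 : (1 : ℝ) ≤ Real.exp (19 / 400 * p * (A j).card) *
      Real.exp (-(1 / 20) * (R ∩ A j).card) := by
      rw [← Real.exp_add]
      exact Real.one_le_exp (by linarith)
    have h3 : 0 ≤ (∑ t ∈ R, w t) / (p * W) := by positivity
    simp only [hF] at hFR
    linarith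

end Sampling

/-! ### Sorting, shifting and rounding inside the buckets of one vertex. -/

section Shift

theorem exists_monotone_enumeration {ι : Type*} [DecidableEq ι] (A : Finset ι) (s : ι → ℕ)
    (hA : A.Nonempty) :
    ∃ (a : ℕ → ι) (pos : ι → ℕ), (∀ j, j < A.card → a j ∈ A ∧ pos (a j) = j) ∧
      (∀ t ∈ A, pos t < A.card ∧ a (pos t) = t) ∧
      ∀ i j, i ≤ j → j < A.card → s (a i) ≤ s (a j) := by
  obtain ⟨t₀, -⟩ := hA
  set e : Fin A.card ≃ A := (Tuple.sort fun i => s (A.equivFin.symm i)).trans A.equivFin.symm with he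
  have hmono : Monotone fun i => s (e i) := Tuple.monotone_sort fun i => s (A.equivFin.symm i)
  refine ⟨fun j => if h : j < A.card then e ⟨j, h⟩ else t₀,
    fun t => if h : t ∈ A then e.symm ⟨t, h⟩ else 0, fun j hj => ?_, fun t ht => ?_,
    fun i j hij hj => ?_⟩
  · simp [hj]
  · simp [ht]
  · simp only [dif_pos hj, dif_pos (lt_of_le_of_lt hij hj)]
    exact hmono (show (⟨i, _⟩ : Fin A.card) ≤ ⟨j, hj⟩ from hij)

/-- Items of a bucket, ordered by size, are shifted by `|E|` positions; the items of the top group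
go to the extra carriers `E`, and every item is rounded up to the largest size of its group. -/
theorem exists_shift {ι κ : Type*} [DecidableEq ι] [DecidableEq κ] (A : Finset ι) (s : ι → ℕ)
    (E : Finset κ) {g : ℕ} (hE : A.card ≤ g * E.card) :
    ∃ (c : ι → ι ⊕ κ) (z : ι → ℕ), Set.InjOn c A ∧
      (∀ t ∈ A, (∃ t' ∈ A, c t = Sum.inl t' ∧ z t ≤ s t') ∨ ∃ e ∈ E, c t = Sum.inr e) ∧
      (∀ t ∈ A, s t ≤ z t ∧ ∃ t' ∈ A, z t = s t') ∧ (A.image z).card ≤ g := by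
  rcases A.eq_empty_or_nonempty with rfl | hA
  · exact ⟨Sum.inl, s, by simp, by simp, by simp, by simp⟩
  have hb : 0 < A.card := hA.card_pos
  set b := A.card with hbdef
  set q := E.card with hq
  have hq0 : 0 < q := by
    rcases Nat.eq_zero_or_pos q with h | h
    · rw [h] at hE; omega
    · exact h
  obtain ⟨a, pos, ha, hpos, hmono⟩ := exists_monotone_enumeration A s hA
  obtain ⟨e, pos', he, -, -⟩ := exists_monotone_enumeration E (fun _ => 0) (card_pos.1 hq0)
  have hdiv : ∀ t, pos t / q * q ≤ pos t ∧ pos t < pos t / q * q + q := fun t =>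
    ⟨Nat.div_mul_le_self _ _, Nat.lt_div_mul_add hq0⟩
  -- Position `k` moves to slot `k + q`, the last `q` positions to `E`. The size is rounded up to
  -- that of the end of its block, a position at most `k + q - 1`, hence to no more than the size of
  -- the new slot. The minimum with `b - 1` closes an incomplete last block.
  refine ⟨fun t => if pos t + q < b then Sum.inl (a (pos t + q)) else Sum.inr (e (pos t + q - b)),
    fun t => s (a (min (pos t / q * q + q - 1) (b - 1))), ?_, fun t ht => ?_, fun t ht => ?_, ?_⟩
  · intro t ht t' ht' h
    have h1 := hpos t ht
    have h2 := hpos t' ht'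
    have key : pos t = pos t' := by
      simp only at h
      split_ifs at h with hc hc' hc'
      · have := congrArg pos (Sum.inl_injective h)
        rw [(ha _ hc).2, (ha _ hc').2] at this
        omega
      · have := congrArg pos' (Sum.inr_injective h)
        rw [(he _ (by omega)).2, (he _ (by omega)).2] at this
        omega
    rw [← h1.2, ← h2.2, key]
  · have h1 := hpos t ht
    have h2 := hdiv t
    by_cases hc : pos t + q < b
    · refine Or.inl ⟨a (pos t + q), (ha _ hc).1, if_pos hc, hmono _ _ ?_ hc⟩
      omega
    · exact Or.inr ⟨e (pos t + q - b), (he _ (by omega)).1, if_neg hc⟩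
  · have h1 := hpos t ht
    have h2 := hdiv t
    refine ⟨?_, _, (ha (min (pos t / q * q + q - 1) (b - 1)) (by omega)).1, rfl⟩
    nth_rewrite 1 [← h1.2]
    exact hmono _ _ (by omega) (by omega)
  · calc (A.image fun t => s (a (min (pos t / q * q + q - 1) (b - 1)))).card
        ≤ ((range g).image fun k => s (a (min (k * q + q - 1) (b - 1)))).card := by
          refine card_le_card fun x hx => ?_
          obtain ⟨t, ht, rfl⟩ := mem_image.1 hx
          refine mem_image.2 ⟨pos t / q, mem_range.2 ?_, rfl⟩
          rw [Nat.div_lt_iff_lt_mul hq0]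
          have := (hpos t ht).1
          omega
      _ ≤ g := card_image_le.trans (card_range g).le

/-- Every bucket of the family `s` of sizes is small or has at most `g` different sizes. -/
def HasFewSizes {ι : Type*} [Fintype ι] (ε : ℝ) (Q : ℕ) (L : ℝ) (g : ℕ) (s : ι → ℕ) : Prop :=
  ∀ i, 1 ≤ i → ((univ.filter fun t => bucketIndex ε Q (s t) = i).card : ℝ) ≤ L ∨
    ((univ.filter fun t => bucketIndex ε Q (s t) = i).image s).card ≤ g

/-- `exists_shift` is applied to each big bucket, and all other sizes stay in place. A carrier
belongs to the bucket of its owner `o e`, so the shifts of different buckets do not collide and glue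
to an injection, which extends to a permutation. Rounding keeps every size in its bucket, so a
bucket that was small remains small. -/
theorem exists_rearrangement {ι κ : Type*} [Fintype ι] [Fintype κ] [DecidableEq ι] [DecidableEq κ]
    {ε L : ℝ} {Q g : ℕ} (hε : 0 < ε) (hε1 : ε < 1) (hQ : 0 < Q) (s : ι → ℕ)
    (hs : ∀ t, s t ≤ Q) (o : κ → ι) (D : Finset κ)
    (hD : ∀ i, 1 ≤ i → L < (univ.filter fun t => bucketIndex ε Q (s t) = i).card →
      (univ.filter fun t => bucketIndex ε Q (s t) = i).card ≤
        g * (D.filter fun e => bucketIndex ε Q (s (o e)) = i).card) :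
    ∃ (σ : Equiv.Perm (ι ⊕ κ)) (z : ι → ℕ), (∀ t, s t ≤ z t) ∧ (∀ t, s t = 0 → z t = 0) ∧
      (∀ t, z t ≤ Q) ∧ (∀ t t', σ (Sum.inl t) = Sum.inl t' → z t ≤ s t') ∧
      (∀ t e, σ (Sum.inl t) = Sum.inr e → e ∈ D ∧ z t ≤ 2 * s (o e)) ∧
      HasFewSizes ε Q L g z := by
  classical
  set β : ι → ℕ := fun t => bucketIndex ε Q (s t) with hβ
  set A : ℕ → Finset ι := fun i => univ.filter fun t => β t = i with hA
  set big : ℕ → Prop := fun i => 1 ≤ i ∧ L < (A i).card with hbig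
  have hex : ∀ i, ∃ (c : ι → ι ⊕ κ) (z : ι → ℕ), big i → Set.InjOn c (A i) ∧
      (∀ t ∈ A i, (∃ t' ∈ A i, c t = Sum.inl t' ∧ z t ≤ s t') ∨
        ∃ e ∈ D.filter fun e => bucketIndex ε Q (s (o e)) = i, c t = Sum.inr e) ∧
      (∀ t ∈ A i, s t ≤ z t ∧ ∃ t' ∈ A i, z t = s t') ∧ ((A i).image z).card ≤ g := by
    intro i
    by_cases h : big i
    · obtain ⟨c, z, hcz⟩ := exists_shift (A i) s _ (hD i h.1 h.2)
      exact ⟨c, z, fun _ => hcz⟩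
    · exact ⟨Sum.inl, s, fun h' => absurd h' h⟩
  choose c z hcz using hex
  have hmem : ∀ t, t ∈ A (β t) := fun t => by simp [hA]
  have hmemA : ∀ {t i}, t ∈ A i → β t = i := fun {t i} h => by simpa [hA] using h
  set c' : ι → ι ⊕ κ := fun t => if big (β t) then c (β t) t else Sum.inl t with hc'
  set z' : ι → ℕ := fun t => if big (β t) then z (β t) t else s t with hz'
  have hcl : ∀ t t', c' t = Sum.inl t' → β t' = β t ∧ z' t ≤ s t' := by
    intro t t' h
    simp only [hc', hz'] at h ⊢
    split_ifs at h ⊢ with hb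
    · rcases (hcz _ hb).2.1 t (hmem t) with ⟨u, hu, hcu, hzu⟩ | ⟨e, -, he⟩
      · rw [hcu] at h
        obtain rfl := Sum.inl_injective h
        exact ⟨hmemA hu, hzu⟩
      · rw [he] at h; exact absurd h (by simp)
    · obtain rfl := Sum.inl_injective h
      exact ⟨rfl, le_rfl⟩
  have hcr : ∀ t e, c' t = Sum.inr e → big (β t) ∧ e ∈ D ∧ β (o e) = β t := by
    intro t e h
    simp only [hc'] at h
    split_ifs at h with hb
    · rcases (hcz _ hb).2.1 t (hmem t) with ⟨u, hu, hcu, hzu⟩ | ⟨e', he', he⟩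
      · rw [hcu] at h; exact absurd h (by simp)
      · rw [he] at h
        obtain rfl := Sum.inr_injective h
        rw [mem_filter] at he'
        exact ⟨hb, he'.1, he'.2⟩
  have hcβ : ∀ t t', c' t = c' t' → β t = β t' := by
    intro t t' h
    rcases hct : c' t with u | e
    · rw [← (hcl t u hct).1, (hcl t' u (h ▸ hct)).1]
    · rw [← (hcr t e hct).2.2, (hcr t' e (h ▸ hct)).2.2]
  have hinj : Function.Injective c' := by
    intro t t' h
    have hbt := hcβ t t' h
    simp only [hc', ← hbt] at h
    split_ifs at h with hb
    · exact (hcz _ hb).1 (hmem t) (by rw [hbt]; exact hmem t') h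
    · exact Sum.inl_injective h
  obtain ⟨σ', hσ'⟩ := Finset.exists_equiv_extend_of_card_eq (α := ι ⊕ κ) (t := (univ : Finset (ι ⊕ κ)))
    (by simp) (s := univ.image Sum.inl) (f := Sum.elim c' Sum.inr) (subset_univ _) (by
      intro x hx y hy h
      simp only [coe_image, coe_univ, Set.image_univ, Set.mem_range] at hx hy
      obtain ⟨t, rfl⟩ := hx
      obtain ⟨t', rfl⟩ := hy
      exact congrArg _ (hinj (by simpa using h)))
  set σ : Equiv.Perm (ι ⊕ κ) := σ'.trans (Equiv.subtypeUnivEquiv fun x => mem_univ x) with hσ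
  have hσc : ∀ t, σ (Sum.inl t) = c' t := fun t => hσ' (Sum.inl t) (by simp)
  have hzs : ∀ t, s t ≤ z' t ∧ ∃ t', β t' = β t ∧ z' t = s t' := by
    intro t
    simp only [hz']
    split_ifs with hb
    · obtain ⟨h1, t', h2, h3⟩ := (hcz _ hb).2.2.1 t (hmem t)
      exact ⟨h1, t', hmemA h2, h3⟩
    · exact ⟨le_rfl, t, rfl, rfl⟩
  have hzβ : ∀ t, bucketIndex ε Q (z' t) = β t := by
    intro t
    obtain ⟨-, t', h1, h2⟩ := hzs t
    rw [h2, ← h1]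
  have hzQ : ∀ t, z' t ≤ Q := fun t => by
    obtain ⟨-, t', -, h2⟩ := hzs t
    rw [h2]; exact hs t'
  refine ⟨σ, z', fun t => (hzs t).1, fun t ht => ?_, hzQ, fun t t' h => ?_, fun t e h => ?_,
    fun i hi => ?_⟩
  · rw [← bucketIndex_eq_zero_iff hε hQ (hzQ t), hzβ, hβ]
    exact (bucketIndex_eq_zero_iff hε hQ (hs t)).2 ht
  · rw [hσc] at h; exact (hcl t t' h).2
  · rw [hσc] at h
    obtain ⟨-, h1, h2⟩ := hcr t e h
    refine ⟨h1, ?_⟩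
    have h3 := inBucketSize_bucketIndex hε hQ (hzQ t)
    have h4 := inBucketSize_bucketIndex hε hQ (hs (o e))
    rw [hzβ] at h3
    rw [show bucketIndex ε Q (s (o e)) = β t from h2] at h4
    exact h3.le_two_mul hε hε1 (hzQ t) h4
  · simp only [hzβ]
    by_cases hb : big i
    · right
      refine le_trans (le_of_eq ?_) (hcz i hb).2.2.2
      congr 1
      refine Finset.image_congr fun t ht => ?_
      have : β t = i := by simpa using ht
      simp only [hz', this, if_pos hb]
    · left
      simp only [hbig, not_and, not_lt] at hb
      exact hb hi

end Shift

/-! ### Rounding one level of the tree. -/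

section Level

/-- Let `P` be a subset with as many elements as possible among those of sum at most `Q`. Any
further `x` takes it above `Q`, so `P`, `{x}` and the remainder all fit. -/
theorem exists_three_bins {V : Type*} [DecidableEq V] (U : Finset V) (a : V → ℕ) {Q : ℕ}
    (ha : ∀ v, a v ≤ Q) (hU : ∑ v ∈ U, a v ≤ 2 * Q) :
    ∃ f : V → Fin 3, ∀ j, ∑ v ∈ U.filter (fun v => f v = j), a v ≤ Q := by
  obtain ⟨P, hP, hmax⟩ := Finset.exists_max_image
    (U.powerset.filter fun P => ∑ v ∈ P, a v ≤ Q) card ⟨∅, by simp⟩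
  simp only [mem_filter, mem_powerset] at hP hmax
  have hsplit : ∑ v ∈ U \ P, a v + ∑ v ∈ P, a v = ∑ v ∈ U, a v := Finset.sum_sdiff hP.1
  by_cases hUP : U \ P = ∅
  · refine ⟨fun _ => 0, fun j => ?_⟩
    rw [hUP, sum_empty, zero_add] at hsplit
    exact (Finset.sum_le_sum_of_subset (filter_subset _ _)).trans (hsplit ▸ hP.2)
  · obtain ⟨x, hx⟩ := Finset.nonempty_iff_ne_empty.2 hUP
    rw [mem_sdiff] at hx
    have hgt : Q < a x + ∑ v ∈ P, a v := by
      by_contra hc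
      have := hmax (insert x P) ⟨insert_subset hx.1 hP.1, by rw [sum_insert hx.2]; omega⟩
      rw [card_insert_of_notMem hx.2] at this
      omega
    refine ⟨fun v => if v ∈ P then 0 else if v = x then 1 else 2, fun j => ?_⟩
    fin_cases j
    · refine (Finset.sum_le_sum_of_subset fun v hv => ?_).trans hP.2
      simp only [mem_filter] at hv
      by_contra h
      rw [if_neg h] at hv
      split_ifs at hv <;> simp at hv
    · refine (Finset.sum_le_sum_of_subset (t := {x}) fun v hv => ?_).trans (by simpa using ha x)
      simp only [mem_filter] at hv
      by_contra h
      rw [mem_singleton] at h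
      rw [if_neg h] at hv
      split_ifs at hv <;> simp at hv
    · have h1 : ∑ v ∈ (U \ P).erase x, a v + a x = ∑ v ∈ U \ P, a v :=
        Finset.sum_erase_add _ _ (mem_sdiff.2 hx)
      refine (Finset.sum_le_sum_of_subset (t := (U \ P).erase x) fun v hv => ?_).trans (by omega)
      simp only [mem_filter] at hv
      rw [mem_erase, mem_sdiff]
      refine ⟨fun h => ?_, hv.1, fun h => ?_⟩
      · subst h; simp [hx.2] at hv
      · simp [h] at hv

/-- The slots left empty have size 0, and bucket 0 is not subject to any condition. -/
theorem HasFewSizes.rearrange {ι κ : Type*} [Fintype ι] [Fintype κ] {ε L : ℝ} {Q g : ℕ}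
    (hε : 0 < ε) (hQ : 0 < Q) {z : ι → ℕ} (hz : HasFewSizes ε Q L g z) (σ : Equiv.Perm (ι ⊕ κ))
    {S : ι ⊕ κ → ℕ} (hS : ∀ T, S (σ T) = Sum.elim z (fun _ => 0) T) :
    HasFewSizes ε Q L g S := by
  classical
  intro i hi
  have himg : (univ.filter fun T => bucketIndex ε Q (S T) = i) =
      (univ.filter fun t => bucketIndex ε Q (z t) = i).image fun t => σ (Sum.inl t) := by
    ext T
    obtain ⟨T, rfl⟩ := σ.surjective T
    simp only [mem_filter, mem_univ, true_and, mem_image, hS, σ.injective.eq_iff]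
    rcases T with t | e
    · simp
    · have := (bucketIndex_eq_zero_iff hε hQ (Nat.zero_le Q)).2 rfl
      simp only [Sum.elim_inr, this, reduceCtorEq, and_false, exists_false, iff_false]
      omega
  have hinj : Function.Injective fun t => σ (Sum.inl t) := σ.injective.comp Sum.inl_injective
  rw [himg, card_image_of_injective _ hinj, image_image]
  have : (S ∘ fun t => σ (Sum.inl t)) = z := by
    ext t; simp [hS]
  rw [this]
  exact hz i hi

theorem three_mul_sum {ι : Type*} (R : Finset ι) (f : ι → ℕ) :
    3 * ∑ t ∈ R, f t = ∑ e : R × Fin 3, f e.1 := by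
  rw [Fintype.sum_prod_type, ← Finset.sum_coe_sort R, Finset.mul_sum]
  simp

variable {V : Type*} [Fintype V] (N : TreeNetwork V)

theorem sum_eq_sum_level [DecidableEq V] (l : ℕ) (f : V → ℕ) :
    ∑ u, f u = ∑ u ∈ univ.filter (fun u => N.depth u < l), f u +
      ∑ v ∈ univ.filter (fun v => N.depth v = l), N.cov f v := by
  simp only [cov]
  rw [← Finset.sum_biUnion, ← Finset.sum_filter_add_sum_filter_not univ (fun u => N.depth u < l)]
  · congr 1
    refine Finset.sum_congr ?_ fun _ _ => rfl
    ext u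
    simp only [mem_filter, mem_univ, true_and, mem_biUnion, not_lt]
    constructor
    · intro h; exact N.exists_ancestor h
    · rintro ⟨v, rfl, hu⟩; exact N.depth_le_of_mem_subtree hu
  · intro v hv w hw hvw
    simp only [coe_filter, mem_univ, true_and, Set.mem_ofPred_eq] at hv hw
    exact N.disjoint_subtree hvw (hv.trans hw.symm)

/-- Nothing moves above depth `l`, and from `l` down whole subtree loads are permuted. An edge at or
below the level is therefore used by no more tours than before. Above it, an old tour uses only
edges that it used already, and an extra tour only edges of the sampled tour it copies, which
accounts for the three copies of `R` in the cost. -/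
theorem exists_level {ι : Type} [Fintype ι] [DecidableEq ι] {ε L : ℝ} {g : ℕ} (hε : 0 < ε)
    (hε1 : ε < 1) (hQ : 0 < N.capacity) (x : ι → V → ℕ) (hx : ∀ t, ∑ v, x t v ≤ N.capacity) (l : ℕ)
    (R : Finset ι)
    (hR : ∀ v, N.depth v = l → ∀ i, 1 ≤ i →
      L < (univ.filter fun t => bucketIndex ε N.capacity (N.cov (x t) v) = i).card →
      (univ.filter fun t => bucketIndex ε N.capacity (N.cov (x t) v) = i).card ≤
        g * (R ∩ univ.filter fun t => bucketIndex ε N.capacity (N.cov (x t) v) = i).card)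
    (hgood : ∀ v, l < N.depth v → HasFewSizes ε N.capacity L g fun t => N.cov (x t) v) :
    ∃ y : ι ⊕ (R × Fin 3) → V → ℕ, (∀ T, ∑ v, y T v ≤ N.capacity) ∧
      (∀ v, ∑ t, x t v ≤ ∑ T, y T v) ∧
      (∑ T, N.loadCost (y T) ≤ ∑ t, N.loadCost (x t) + 3 * ∑ t ∈ R, N.loadCost (x t)) ∧
      ∀ v, l ≤ N.depth v → HasFewSizes ε N.capacity L g fun T => N.cov (y T) v := by
  classical
  have hsQ : ∀ t v, N.cov (x t) v ≤ N.capacity := fun t v => (N.cov_le_sum _ _).trans (hx t)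
  set U : Finset V := univ.filter fun v => N.depth v = l with hU
  have hbin : ∀ t, ∃ f : V → Fin 3, ∀ j,
      ∑ v ∈ U.filter (fun v => f v = j), min (2 * N.cov (x t) v) N.capacity ≤ N.capacity := by
    intro t
    refine exists_three_bins U _ (fun v => min_le_right _ _) ?_
    calc ∑ v ∈ U, min (2 * N.cov (x t) v) N.capacity ≤ ∑ v ∈ U, 2 * N.cov (x t) v :=
          Finset.sum_le_sum fun v _ => min_le_left _ _
      _ ≤ 2 * ∑ v, x t v := by
          rw [← Finset.mul_sum, N.sum_eq_sum_level l (x t)]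
          exact Nat.mul_le_mul_left _ (Nat.le_add_left _ _)
      _ ≤ _ := Nat.mul_le_mul_left _ (hx t)
  choose bin hbin using hbin
  have hre : ∀ v, ∃ (σ : Equiv.Perm (ι ⊕ (R × Fin 3))) (z : ι → ℕ), N.depth v = l →
      (∀ t, N.cov (x t) v ≤ z t) ∧ (∀ t, N.cov (x t) v = 0 → z t = 0) ∧
      (∀ t, z t ≤ N.capacity) ∧ (∀ t t', σ (Sum.inl t) = Sum.inl t' → z t ≤ N.cov (x t') v) ∧
      (∀ t e, σ (Sum.inl t) = Sum.inr e →
        bin e.1 v = e.2 ∧ z t ≤ 2 * N.cov (x e.1) v) ∧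
      HasFewSizes ε N.capacity L g z := by
    intro v
    by_cases hv : N.depth v = l
    -- Of the three copies of a sampled tour, only the one whose bin contains `v` is a carrier at
    -- `v`.
    · obtain ⟨σ, z, h1, h2, h3, h4, h5, h6⟩ := exists_rearrangement (L := L) (g := g)
        hε hε1 hQ (fun t => N.cov (x t) v)
        (fun t => hsQ t v) (fun e : R × Fin 3 => (e.1 : ι))
        (univ.filter fun e : R × Fin 3 => bin e.1 v = e.2) (by
          intro i hi hL
          refine (hR v hv i hi hL).trans (Nat.mul_le_mul_left _ ?_)
          refine Finset.card_le_card_of_surjOn (fun e : R × Fin 3 => (e.1 : ι)) ?_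
          intro t ht
          simp only [coe_inter, coe_filter, mem_univ, true_and, Set.mem_inter_iff, mem_coe,
            Set.mem_ofPred_eq] at ht
          refine ⟨(⟨t, ht.1⟩, bin t v), ?_, rfl⟩
          simp [ht.2])
      refine ⟨σ, z, fun _ => ⟨h1, h2, h3, h4, fun t e he => ?_, h6⟩⟩
      obtain ⟨h7, h8⟩ := h5 t e he
      exact ⟨by simpa using h7, h8⟩
    · exact ⟨Equiv.refl _, fun _ => 0, fun h => absurd h hv⟩
  choose σ z hσz using hre
  have htop : ∀ u, ∃ v, l ≤ N.depth u → N.depth v = l ∧ u ∈ N.subtree v := by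
    intro u
    by_cases h : l ≤ N.depth u
    · obtain ⟨v, hv⟩ := N.exists_ancestor h
      exact ⟨v, fun _ => hv⟩
    · exact ⟨u, fun h' => absurd h' h⟩
  choose top htop using htop
  have htop_eq : ∀ {u v}, N.depth v = l → u ∈ N.subtree v → top u = v := by
    intro u v hv hu
    obtain ⟨h1, h2⟩ := htop u (hv ▸ N.depth_le_of_mem_subtree hu)
    by_contra hne
    exact Finset.disjoint_left.1 (N.disjoint_subtree hne (h1.trans hv.symm)) h2 hu
  set x' : ι ⊕ (R × Fin 3) → V → ℕ := Sum.elim x (fun _ _ => 0) with hx'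
  -- The dummy tokens sit at the vertex of level `l` itself, so no size below it changes; the
  -- subtraction is exact because `z` only rounds up.
  set pad : V → ι ⊕ (R × Fin 3) → ℕ :=
    fun v => Sum.elim (fun t => z v t - N.cov (x t) v) (fun _ => 0) with hpad
  set y : ι ⊕ (R × Fin 3) → V → ℕ := fun T u =>
    if l ≤ N.depth u then
      x' ((σ (top u)).symm T) u + if N.depth u = l then pad u ((σ u).symm T) else 0
    else x' T u with hy
  have hcov_deep : ∀ w, l < N.depth w → ∀ T, N.cov (y T) w = N.cov (x' ((σ (top w)).symm T)) w := by
    intro w hw T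
    refine Finset.sum_congr rfl fun u hu => ?_
    obtain ⟨h1, h2⟩ := htop w hw.le
    have h3 := N.depth_le_of_mem_subtree hu
    have h4 : top u = top w := htop_eq h1 (N.mem_subtree_trans hu h2)
    simp only [hy]
    rw [if_pos (by omega), if_neg (by omega), h4, add_zero]
  have hcov_level : ∀ w, N.depth w = l → ∀ T,
      N.cov (y T) w = Sum.elim (z w) (fun _ => 0) ((σ w).symm T) := by
    intro w hw T
    have h1 : N.cov (y T) w = N.cov (x' ((σ w).symm T)) w + pad w ((σ w).symm T) := by
      simp only [cov]
      rw [← Finset.add_sum_erase _ _ (N.self_mem_subtree w),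
        ← Finset.add_sum_erase _ _ (N.self_mem_subtree w)]
      have h2 : y T w = x' ((σ w).symm T) w + pad w ((σ w).symm T) := by
        simp only [hy]
        rw [if_pos hw.ge, if_pos hw, htop_eq hw (N.self_mem_subtree w)]
      rw [h2, add_right_comm]
      congr 2
      refine Finset.sum_congr rfl fun u hu => ?_
      rw [mem_erase] at hu
      have h3 := N.depth_le_of_mem_subtree hu.2
      have h4 : N.depth u ≠ l := fun h =>
        hu.1 (N.eq_of_mem_subtree_of_depth_eq hu.2 (h.trans hw.symm))
      simp only [hy]
      rw [if_pos (by omega), if_neg h4, htop_eq hw hu.2, add_zero]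
    rw [h1]
    rcases (σ w).symm T with t | e
    · simp only [hx', hpad, Sum.elim_inl]
      exact Nat.add_sub_cancel' ((hσz w hw).1 t)
    · simp [hx', hpad, cov]
  have hcov_inl : ∀ w, N.depth w = l → ∀ t, N.cov (y (Sum.inl t)) w ≤ N.cov (x t) w := by
    intro w hw t
    rw [hcov_level w hw]
    rcases h : (σ w).symm (Sum.inl t) with t' | e
    · rw [Equiv.symm_apply_eq] at h
      exact (hσz w hw).2.2.2.1 t' t h.symm
    · exact Nat.zero_le _
  have hcov_inr : ∀ w, N.depth w = l → ∀ e, N.cov (y (Sum.inr e)) w ≤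
      if bin e.1 w = e.2 then min (2 * N.cov (x e.1) w) N.capacity else 0 := by
    intro w hw e
    rw [hcov_level w hw]
    rcases h : (σ w).symm (Sum.inr e) with t' | e'
    · rw [Equiv.symm_apply_eq] at h
      obtain ⟨h1, h2⟩ := (hσz w hw).2.2.2.2.1 t' e h.symm
      rw [if_pos h1]
      exact le_min h2 ((hσz w hw).2.2.1 t')
    · exact Nat.zero_le _
  refine ⟨y, ?_, ?_, ?_, ?_⟩
  · rintro (t | e)
    · refine le_trans ?_ (hx t)
      rw [N.sum_eq_sum_level l, N.sum_eq_sum_level l (x t)]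
      refine add_le_add (Finset.sum_le_sum fun u hu => ?_) (Finset.sum_le_sum fun v hv => ?_)
      · simp only [hy]
        rw [if_neg (by simpa using hu)]
        simp [hx']
      · exact hcov_inl v (by simpa using hv) t
    · rw [N.sum_eq_sum_level l]
      refine le_trans ?_ (hbin e.1 e.2)
      have h0 : ∑ u ∈ univ.filter (fun u => N.depth u < l), y (Sum.inr e) u = 0 := by
        refine Finset.sum_eq_zero fun u hu => ?_
        simp only [hy]
        rw [if_neg (by simpa using hu)]
        simp [hx']
      rw [h0, zero_add, Finset.sum_filter (p := fun v => bin e.1 v = e.2)]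
      exact Finset.sum_le_sum fun v hv => hcov_inr v (by simpa [hU] using hv) e
  · intro u
    have h1 : ∑ T, x' T u = ∑ t, x t u := by
      simp [hx', Fintype.sum_sum_type]
    rw [← h1]
    by_cases hu : l ≤ N.depth u
    · rw [← Equiv.sum_comp (σ (top u)).symm]
      refine Finset.sum_le_sum fun T _ => ?_
      simp only [hy]
      rw [if_pos hu]
      exact Nat.le_add_right _ _
    · simp only [hy, if_neg hu]
      exact le_rfl
  · have key : ∀ w, ∑ T, (if 0 < N.cov (y T) w then N.edgeCost w else 0) ≤
        ∑ t, (if 0 < N.cov (x t) w then N.edgeCost w else 0) +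
          3 * ∑ t ∈ R, if 0 < N.cov (x t) w then N.edgeCost w else 0 := by
      intro w
      by_cases hw : l ≤ N.depth w
      · refine le_trans ?_ (Nat.le_add_right _ _)
        have h1 : ∑ t, (if 0 < N.cov (x t) w then N.edgeCost w else 0) =
            ∑ T, if 0 < N.cov (x' T) w then N.edgeCost w else 0 := by
          rw [Fintype.sum_sum_type, Fintype.sum_eq_zero (α := R × Fin 3), add_zero]
          · simp [hx']
          · simp [hx', cov]
        rw [h1, ← Equiv.sum_comp (σ (top w)).symm
          fun T => if 0 < N.cov (x' T) w then N.edgeCost w else 0]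
        refine Finset.sum_le_sum fun T _ => ?_
        have h2 : 0 < N.cov (y T) w → 0 < N.cov (x' ((σ (top w)).symm T)) w := by
          rcases hw.eq_or_lt with hw | hw
          · rw [hcov_level w hw.symm, htop_eq hw.symm (N.self_mem_subtree w)]
            rcases (σ w).symm T with t | e
            · simp only [hx', Sum.elim_inl]
              have := (hσz w hw.symm).2.1 t
              omega
            · simp
          · rw [hcov_deep w hw]; exact id
        split_ifs with h3 h4
        · exact le_rfl
        · exact absurd (h2 h3) h4
        · exact Nat.zero_le _
        · exact Nat.zero_le _
      · have hpos : ∀ T, 0 < N.cov (y T) w → 0 < N.cov (x' T) w ∨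
            ∃ v ∈ N.subtree w, N.depth v = l ∧ 0 < N.cov (y T) v := by
          intro T hT
          obtain ⟨u, hu, hyu⟩ := N.cov_pos_iff.1 hT
          by_cases hul : l ≤ N.depth u
          · right
            obtain ⟨h1, h2⟩ := htop u hul
            exact ⟨top u, N.mem_subtree_of_common hu h2 (by omega), h1,
              N.cov_pos_iff.2 ⟨u, h2, hyu⟩⟩
          · left
            simp only [hy, if_neg hul] at hyu
            exact N.cov_pos_iff.2 ⟨u, hu, hyu⟩
        have hup : ∀ t v, v ∈ N.subtree w → 0 < N.cov (x t) v → 0 < N.cov (x t) w := by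
          intro t v hv h
          obtain ⟨u, hu, h⟩ := N.cov_pos_iff.1 h
          exact N.cov_pos_iff.2 ⟨u, N.mem_subtree_trans hu hv, h⟩
        have hl : ∀ t, 0 < N.cov (y (Sum.inl t)) w → 0 < N.cov (x t) w := by
          intro t h
          rcases hpos _ h with h | ⟨v, hv, hvl, h⟩
          · exact h
          · exact hup t v hv (h.trans_le (hcov_inl v hvl t))
        have hr : ∀ e : R × Fin 3, 0 < N.cov (y (Sum.inr e)) w → 0 < N.cov (x e.1) w := by
          intro e h
          rcases hpos _ h with h | ⟨v, hv, hvl, h⟩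
          · simp [hx', cov] at h
          · have h1 := h.trans_le (hcov_inr v hvl e)
            split_ifs at h1
            · exact hup _ v hv (by omega)
            · omega
        rw [three_mul_sum R fun t => if 0 < N.cov (x t) w then N.edgeCost w else 0,
          Fintype.sum_sum_type]
        refine add_le_add (Finset.sum_le_sum fun t _ => ?_) (Finset.sum_le_sum fun e _ => ?_)
        · have := hl t
          split_ifs <;> first | exact le_rfl | exact Nat.zero_le _ | (exfalso; tauto)
        · have := hr e
          split_ifs <;> first | exact le_rfl | exact Nat.zero_le _ | (exfalso; tauto)
    have e1 : ∑ T, N.loadCost (y T) =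
        ∑ w, ∑ T, if 0 < N.cov (y T) w then N.edgeCost w else 0 := Finset.sum_comm
    have e2 : ∑ t, N.loadCost (x t) =
        ∑ w, ∑ t, if 0 < N.cov (x t) w then N.edgeCost w else 0 := Finset.sum_comm
    have e3 : ∑ t ∈ R, N.loadCost (x t) =
        ∑ w, ∑ t ∈ R, if 0 < N.cov (x t) w then N.edgeCost w else 0 := Finset.sum_comm
    rw [e1, e2, e3, Finset.mul_sum, ← Finset.sum_add_distrib]
    exact Finset.sum_le_sum fun w _ => key w
  · intro w hw
    rcases hw.eq_or_lt with hw | hw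
    · refine (hσz w hw.symm).2.2.2.2.2.rearrange hε hQ (σ w) fun T => ?_
      rw [hcov_level w hw.symm, Equiv.symm_apply_apply]
    · refine (hgood w hw).rearrange hε hQ (σ (top w)) fun T => ?_
      rw [hcov_deep w hw, Equiv.symm_apply_apply]
      rcases T with t | e
      · rfl
      · simp [hx', cov]

end Level

/-! ### Iteration over the levels. -/

section Iterate

/-- By convexity it is enough to look at `ε = 1`, which amounts to `e ^ 8 ≤ (124/25) ^ 5`. -/
theorem exp_eight_fifths_mul_le {ε : ℝ} (hε : 0 ≤ ε) (hε1 : ε ≤ 1) :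
    Real.exp (8 / 5 * ε) ≤ 1 + 99 / 25 * ε := by
  have h1 : Real.exp (8 / 5) ≤ 124 / 25 := by
    refine le_of_pow_le_pow_left₀ (n := 5) (by norm_num) (by norm_num) ?_
    have h8 : Real.exp (8 / 5) ^ 5 = Real.exp 1 ^ 8 := by
      rw [← Real.exp_nat_mul, ← Real.exp_nat_mul]; norm_num
    rw [h8]
    refine (pow_le_pow_left₀ (Real.exp_pos _).le Real.exp_one_lt_d9.le 8).trans ?_
    norm_num
  have h2 := convexOn_exp.2 (Set.mem_univ 0) (Set.mem_univ (8 / 5 : ℝ))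
    (sub_nonneg.2 hε1) hε (by ring)
  simp only [smul_eq_mul, mul_zero, zero_add, Real.exp_zero, mul_one] at h2
  rw [mul_comm ε] at h2
  have := mul_le_mul_of_nonneg_left h1 hε
  linarith

variable {V : Type*} [Fintype V] (N : TreeNetwork V)

/-- One level of the rounding, with the extra tours sampled from the current ones. The
price `c` per tour keeps the number of tours under control. -/
theorem exists_level_sampled {ι : Type} [Fintype ι] {ε L c K : ℝ} {g H : ℕ} (hε : 0 < ε)
    (hε1 : ε < 1) (hQ : 0 < N.capacity) (hL : 0 ≤ L) (hH : 1 ≤ H) (hg : 2 * H / ε ≤ g)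
    (hc : 0 < c)
    (hK : L < K → 2 * (Fintype.card V * K) *
      Real.exp (-(1 / 800) * (53 / 100 * ε / H) * L) ≤ 3 / 500)
    (x : ι → V → ℕ) (hx : ∀ t, ∑ v, x t v ≤ N.capacity)
    (hΦ : ∑ t, ((N.loadCost (x t) : ℝ) + c) ≤ c * K) (l : ℕ)
    (hgood : ∀ v, l < N.depth v → HasFewSizes ε N.capacity L g fun t => N.cov (x t) v) :
    ∃ (ι' : Type) (_ : Fintype ι') (y : ι' → V → ℕ), (∀ T, ∑ v, y T v ≤ N.capacity) ∧
      (∀ v, ∑ t, x t v ≤ ∑ T, y T v) ∧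
      (∑ T, ((N.loadCost (y T) : ℝ) + c) ≤
        (1 + 8 / 5 * ε / H) * ∑ t, ((N.loadCost (x t) : ℝ) + c)) ∧
      ∀ v, l ≤ N.depth v → HasFewSizes ε N.capacity L g fun T => N.cov (y T) v := by
  classical
  have hH0 : (1 : ℝ) ≤ H := by exact_mod_cast hH
  set Φ := ∑ t, ((N.loadCost (x t) : ℝ) + c) with hΦdef
  have hcard : (Fintype.card ι : ℝ) ≤ K := by
    have h1 : c * Fintype.card ι ≤ Φ := by
      rw [hΦdef, sum_add_distrib, sum_const, card_univ, nsmul_eq_mul, mul_comm]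
      have : 0 ≤ ∑ t, (N.loadCost (x t) : ℝ) := Finset.sum_nonneg fun _ _ => Nat.cast_nonneg _
      linarith
    exact le_of_mul_le_mul_left (h1.trans hΦ) hc
  have hΦ0 : 0 ≤ Φ := Finset.sum_nonneg fun _ _ => by positivity
  set A : V → ℕ → Finset ι :=
    fun v i => univ.filter fun t => bucketIndex ε N.capacity (N.cov (x t) v) = i with hA
  -- The constant has to serve two ends: `g · (19/20) p ≥ 1.007`, so the sample is large enough, and
  -- `3 · 1.006 · 0.53 < 8/5`, so its three copies are cheap enough.
  set p : ℝ := 53 / 100 * ε / H with hp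
  have hp0 : 0 < p := by positivity
  have hp1 : p < 1 := by
    rw [hp, div_lt_one (by positivity)]; linarith
  obtain ⟨R, hRc, hR⟩ : ∃ R : Finset ι,
      ∑ t ∈ R, ((N.loadCost (x t) : ℝ) + c) ≤ (1 + 3 / 500) * p * Φ ∧
      ∀ v i, L < (A v i).card → (A v i).card ≤ g * (R ∩ A v i).card := by
    by_cases hLK : L < Fintype.card ι
    -- A big bucket is named by one of its tours and the vertex, which bounds the family by `n K`
    -- whatever the number of buckets.
    · set J : Finset (ι × V) := univ.filter fun q =>
        L < (A q.2 (bucketIndex ε N.capacity (N.cov (x q.1) q.2))).card with hJ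
      have hJcard : (J.card : ℝ) ≤ Fintype.card V * K := by
        have h1 : J.card ≤ Fintype.card ι * Fintype.card V := by
          rw [← Fintype.card_prod]; exact card_le_univ J
        have h2 : (J.card : ℝ) ≤ Fintype.card ι * Fintype.card V := by exact_mod_cast h1
        refine h2.trans ?_
        rw [mul_comm]
        exact mul_le_mul_of_nonneg_left hcard (Nat.cast_nonneg _)
      obtain ⟨R, hR1, hR2⟩ := exists_sample (L := L) (η := 3 / 500) J
        (fun q => A q.2 (bucketIndex ε N.capacity (N.cov (x q.1) q.2)))
        (fun t => (N.loadCost (x t) : ℝ) + c) (fun t => by positivity) hp0 hp1 (by norm_num)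
        (fun j hj => (mem_filter.1 hj).2.le) (by
          refine le_trans ?_ (hK (hLK.trans_le hcard))
          exact mul_le_mul_of_nonneg_right (by linarith) (Real.exp_pos _).le)
      refine ⟨R, hR1, fun v i hi => ?_⟩
      obtain ⟨t, ht⟩ : (A v i).Nonempty := by
        rw [← card_pos]
        exact_mod_cast hL.trans_lt hi
      have hti : bucketIndex ε N.capacity (N.cov (x t) v) = i := by simpa [hA] using ht
      have h1 := hR2 (t, v) (by simp only [hJ, mem_filter, mem_univ, true_and, hti]; exact hi)
      simp only [hti] at h1
      have h2 : (1 : ℝ) ≤ g * (19 / 20 * p) := by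
        have h3 : 2 * H / ε * (19 / 20 * p) ≤ g * (19 / 20 * p) :=
          mul_le_mul_of_nonneg_right hg (by positivity)
        have h4 : 2 * H / ε * (19 / 20 * p) = 1007 / 1000 := by
          rw [hp]; field_simp; norm_num
        linarith
      have h5 : ((A v i).card : ℝ) ≤ g * (R ∩ A v i).card := by
        calc ((A v i).card : ℝ) ≤ g * (19 / 20 * p) * (A v i).card :=
              le_mul_of_one_le_left (Nat.cast_nonneg _) h2
          _ = g * (19 / 20 * p * (A v i).card) := by ring
          _ ≤ _ := mul_le_mul_of_nonneg_left h1 (Nat.cast_nonneg _)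
      exact_mod_cast h5
    · refine ⟨∅, by simp only [sum_empty]; positivity, fun v i hi => absurd (hi.trans_le ?_) hLK⟩
      exact_mod_cast card_le_univ _
  obtain ⟨y, h1, h2, h3, h4⟩ := N.exists_level hε hε1 hQ x hx l R (fun v _ i _ h => hR v i h) hgood
  refine ⟨_, inferInstance, y, h1, h2, ?_, h4⟩
  have h5 : (∑ T, (N.loadCost (y T) : ℝ)) ≤
      ∑ t, (N.loadCost (x t) : ℝ) + 3 * ∑ t ∈ R, (N.loadCost (x t) : ℝ) := by exact_mod_cast h3
  have h6 : ∑ T, ((N.loadCost (y T) : ℝ) + c) ≤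
      Φ + 3 * ∑ t ∈ R, ((N.loadCost (x t) : ℝ) + c) := by
    rw [hΦdef]
    simp only [sum_add_distrib, sum_const, card_univ, nsmul_eq_mul, Fintype.card_sum,
      Fintype.card_prod, Fintype.card_coe, Fintype.card_fin]
    push_cast
    linarith
  refine h6.trans ?_
  have h7 : 3 * ((1 + 3 / 500) * p * Φ) ≤ 8 / 5 * ε / H * Φ := by
    rw [← mul_assoc]
    refine mul_le_mul_of_nonneg_right ?_ hΦ0
    have : 3 * ((1 + 3 / 500) * p) = (3 * (1 + 3 / 500) * (53 / 100)) * (ε / H) := by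
      rw [hp]; ring
    rw [this, mul_div_assoc]
    exact mul_le_mul_of_nonneg_right (by norm_num) (by positivity)
  linarith

/-- Levels `H, …, 1` are rounded in turn. The factor 5 in the hypothesis exceeds the total growth `1
+ 99ε/25`, so the bound on the number of tours is available at every level. -/
theorem exists_rounding {ι : Type} [Fintype ι] {ε L c K : ℝ} {g H : ℕ} (hε : 0 < ε)
    (hε1 : ε < 1) (hQ : 0 < N.capacity) (hL : 0 ≤ L) (hH : 1 ≤ H) (hg : 2 * H / ε ≤ g)
    (hdepth : ∀ v, N.depth v ≤ H) (hc : 0 < c)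
    (hK : L < K → 2 * (Fintype.card V * K) *
      Real.exp (-(1 / 800) * (53 / 100 * ε / H) * L) ≤ 3 / 500)
    (x : ι → V → ℕ) (hx : ∀ t, ∑ v, x t v ≤ N.capacity)
    (hΦ : 5 * ∑ t, ((N.loadCost (x t) : ℝ) + c) ≤ c * K) :
    ∃ (ι' : Type) (_ : Fintype ι') (y : ι' → V → ℕ), (∀ T, ∑ v, y T v ≤ N.capacity) ∧
      (∀ v, ∑ t, x t v ≤ ∑ T, y T v) ∧
      (∑ T, ((N.loadCost (y T) : ℝ) + c) ≤
        (1 + 99 / 25 * ε) * ∑ t, ((N.loadCost (x t) : ℝ) + c)) ∧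
      ∀ v, v ≠ N.depot → HasFewSizes ε N.capacity L g fun T => N.cov (y T) v := by
  have hH0 : (1 : ℝ) ≤ H := by exact_mod_cast hH
  set Φ := ∑ t, ((N.loadCost (x t) : ℝ) + c) with hΦdef
  have hΦ0 : 0 ≤ Φ := Finset.sum_nonneg fun _ _ => by positivity
  set θ : ℝ := 8 / 5 * ε / H with hθ
  have hθ0 : 0 ≤ θ := by positivity
  have hpow : ∀ k ≤ H, (1 + θ) ^ k ≤ 1 + 99 / 25 * ε := by
    intro k hk
    calc (1 + θ) ^ k ≤ (1 + θ) ^ H := pow_le_pow_right₀ (by linarith) hk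
      _ ≤ Real.exp θ ^ H := pow_le_pow_left₀ (by linarith)
          (by rw [add_comm]; exact Real.add_one_le_exp θ) _
      _ = Real.exp (8 / 5 * ε) := by
          rw [← Real.exp_nat_mul, hθ]; congr 1; field_simp
      _ ≤ _ := exp_eight_fifths_mul_le hε.le hε1.le
  have main : ∀ k ≤ H, ∃ (ι' : Type) (_ : Fintype ι') (y : ι' → V → ℕ),
      (∀ T, ∑ v, y T v ≤ N.capacity) ∧ (∀ v, ∑ t, x t v ≤ ∑ T, y T v) ∧
      (∑ T, ((N.loadCost (y T) : ℝ) + c) ≤ (1 + θ) ^ k * Φ) ∧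
      ∀ v, H < N.depth v + k → HasFewSizes ε N.capacity L g fun T => N.cov (y T) v := by
    intro k
    induction k with
    | zero =>
      intro _
      refine ⟨ι, inferInstance, x, hx, fun v => le_rfl, by simp [hΦdef], fun v hv => ?_⟩
      have := hdepth v
      omega
    | succ k ih =>
      intro hk
      obtain ⟨ι₁, _, y₁, h1, h2, h3, h4⟩ := ih (by omega)
      have h5 : (1 + θ) ^ k * Φ ≤ 5 * Φ :=
        mul_le_mul_of_nonneg_right ((hpow k (by omega)).trans (by linarith)) hΦ0
      obtain ⟨ι₂, i₂, y₂, h6, h7, h8, h9⟩ := N.exists_level_sampled hε hε1 hQ hL hH hg hc hK y₁ h1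
        (h3.trans (h5.trans hΦ)) (H - k) (fun v hv => h4 v (by omega))
      refine ⟨ι₂, i₂, y₂, h6, fun v => (h2 v).trans (h7 v), ?_, fun v hv => h9 v (by omega)⟩
      refine h8.trans ?_
      rw [pow_succ', mul_assoc]
      exact mul_le_mul_of_nonneg_left h3 (by positivity)
  obtain ⟨ι', i', y, h1, h2, h3, h4⟩ := main H le_rfl
  refine ⟨ι', i', y, h1, h2, h3.trans (mul_le_mul_of_nonneg_right (hpow H le_rfl) hΦ0),
    fun v hv => h4 v ?_⟩
  have := mt N.depth_eq_zero.1 hv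
  omega

end Iterate

/-! ### Reduction to few tours that are not full loads at one vertex. -/

section Reduction

variable {V : Type*} [Fintype V] (N : TreeNetwork V)

theorem exists_solution (hQ : 0 < N.capacity) (d : V → ℕ) :
    ∃ S : Multiset N.Tour, IsSolution S d := by
  classical
  have h : ∀ v, ∃ t : N.Tour, t.load = Pi.single v 1 := fun v => by
    obtain ⟨t, ht, -⟩ := N.exists_tour (Pi.single v 1) (by simpa using Nat.succ_le_of_lt hQ)
    exact ⟨t, ht⟩
  choose T hT using h
  refine ⟨(univ : Finset (Σ v, Fin (d v))).val.map fun q => T q.1, fun u => ?_⟩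
  rw [Multiset.map_map]
  change ∑ q : (Σ v, Fin (d v)), (T q.1).load u = d u
  rw [Fintype.sum_sigma]
  simp [hT, Pi.single_apply]

/-- The loads of an optimal solution. -/
theorem exists_optimal_loads (hQ : 0 < N.capacity) (d : V → ℕ) :
    ∃ (m : ℕ) (x : Fin m → V → ℕ), (∀ t, ∑ v, x t v ≤ N.capacity) ∧
      (∀ v, ∑ t, x t v = d v) ∧ ∑ t, N.loadCost (x t) ≤ N.opt d := by
  obtain ⟨S₀, hS₀⟩ := N.exists_solution hQ d
  obtain ⟨S, hS, hc⟩ := Nat.sInf_mem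
    (s := {c | ∃ S : Multiset N.Tour, IsSolution S d ∧ cost S = c}) ⟨_, S₀, hS₀, rfl⟩
  obtain ⟨l, rfl⟩ : ∃ l : List N.Tour, (l : Multiset N.Tour) = S := Quot.exists_rep S
  refine ⟨l.length, fun i => l[i].load, fun t => (l[t]).load_le, fun v => ?_, ?_⟩
  · rw [← hS v, Multiset.map_coe, Multiset.sum_coe]
    exact Fin.sum_univ_fun_getElem l fun t => t.load v
  · rw [opt, ← hc, cost, Multiset.map_coe, Multiset.sum_coe, ← Fin.sum_univ_fun_getElem]
    exact Finset.sum_le_sum fun t _ => N.loadCost_le_cost _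

/-- The vertices at which `x` has tokens. -/
def loadSupport (x : V → ℕ) : Finset V := univ.filter fun v => x v ≠ 0

theorem mem_loadSupport {x : V → ℕ} {v : V} : v ∈ loadSupport x ↔ x v ≠ 0 := by
  simp [loadSupport]

/-- If two loads share two vertices, tokens can be exchanged so that one of the two loads leaves
one of the two vertices. -/
theorem exists_exchange {m : ℕ} (x : Fin m → V → ℕ) {t₁ t₂ : Fin m} (ht : t₁ ≠ t₂) {u v : V}
    (huv : u ≠ v) (h1u : x t₁ u ≠ 0) (h1v : x t₁ v ≠ 0) (h2u : x t₂ u ≠ 0) (h2v : x t₂ v ≠ 0) :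
    ∃ y : Fin m → V → ℕ, (∀ t, ∑ w, y t w = ∑ w, x t w) ∧ (∀ w, ∑ t, y t w = ∑ t, x t w) ∧
      (∀ t w, y t w ≠ 0 → x t w ≠ 0) ∧
      ∑ t, (loadSupport (y t)).card < ∑ t, (loadSupport (x t)).card := by
  classical
  -- `t₁` gives `a` tokens at `u` to `t₂` for `a` tokens at `v`. Both totals are kept, and the
  -- choice of `a` empties `t₁` at `u` or `t₂` at `v`.
  set a := min (x t₁ u) (x t₂ v) with ha
  have ha1 : a ≤ x t₁ u := min_le_left _ _
  have ha2 : a ≤ x t₂ v := min_le_right _ _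
  set y : Fin m → V → ℕ := fun t w =>
    (x t w + (if t = t₁ then if w = v then a else 0 else 0) +
      (if t = t₂ then if w = u then a else 0 else 0)) -
    ((if t = t₁ then if w = u then a else 0 else 0) +
      (if t = t₂ then if w = v then a else 0 else 0)) with hy
  have hyx : ∀ t w, y t w + ((if t = t₁ then if w = u then a else 0 else 0) +
      (if t = t₂ then if w = v then a else 0 else 0)) =
      x t w + (if t = t₁ then if w = v then a else 0 else 0) +
      (if t = t₂ then if w = u then a else 0 else 0) := by
    intro t w
    refine Nat.sub_add_cancel ?_
    by_cases h1 : t = t₁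
    · subst h1
      by_cases hw : w = u
      · subst hw; simp [ht, huv]; omega
      · simp [ht, hw]
    · by_cases h2 : t = t₂
      · subst h2
        by_cases hw : w = v
        · subst hw; simp [h1, huv.symm]; omega
        · simp [h1, hw]
      · simp [h1, h2]
  have hsupp : ∀ t w, y t w ≠ 0 → x t w ≠ 0 := by
    intro t w h0 hx
    have := hyx t w
    rw [hx] at this
    by_cases h1 : t = t₁
    · subst h1
      have hwv : w ≠ v := fun h => h1v (h ▸ hx)
      simp [ht, hwv] at this
      omega
    · by_cases h2 : t = t₂
      · subst h2
        have hwu : w ≠ u := fun h => h2u (h ▸ hx)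
        simp [h1, hwu] at this
        omega
      · simp [h1, h2] at this
        omega
  have hsub : ∀ t, loadSupport (y t) ⊆ loadSupport (x t) := fun t w hw =>
    mem_loadSupport.2 (hsupp t w (mem_loadSupport.1 hw))
  refine ⟨y, fun t => ?_, fun w => ?_, hsupp, ?_⟩
  · have h := Finset.sum_congr (rfl : (univ : Finset V) = univ) fun w _ => hyx t w
    simp only [sum_add_distrib] at h
    have e : ∀ (s : Fin m) (z : V),
        (∑ w : V, if t = s then if w = z then a else 0 else 0) = if t = s then a else 0 := by
      intro s z; split_ifs <;> simp
    simp only [e] at h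
    omega
  · have h := Finset.sum_congr (rfl : (univ : Finset (Fin m)) = univ) fun t _ => hyx t w
    simp only [sum_add_distrib, sum_ite_eq', mem_univ, if_true] at h
    omega
  · refine Finset.sum_lt_sum (fun t _ => card_le_card (hsub t)) ?_
    rcases min_choice (x t₁ u) (x t₂ v) with h | h
    · refine ⟨t₁, mem_univ _, card_lt_card ((Finset.ssubset_iff_of_subset (hsub t₁)).2
        ⟨u, mem_loadSupport.2 h1u, fun hc => mem_loadSupport.1 hc ?_⟩)⟩
      have := hyx t₁ u
      simp [ht, huv] at this
      omega
    · refine ⟨t₂, mem_univ _, card_lt_card ((Finset.ssubset_iff_of_subset (hsub t₂)).2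
        ⟨v, mem_loadSupport.2 h2v, fun hc => mem_loadSupport.1 hc ?_⟩)⟩
      have := hyx t₂ v
      simp [ht.symm, huv.symm] at this
      omega

/-- There is an almost optimal collection of loads in which all but `|V|²` loads are full loads at
a single vertex; `k v` counts those at `v`. -/
theorem exists_reduced_loads [DecidableEq V] (hQ : 0 < N.capacity) (d : V → ℕ) :
    ∃ (ι : Type) (_ : Fintype ι) (x : ι → V → ℕ) (k : V → ℕ),
      Fintype.card ι ≤ Fintype.card V ^ 2 ∧ (∀ t, ∑ v, x t v ≤ N.capacity) ∧
      (∀ v, d v ≤ ∑ t, x t v + k v * N.capacity) ∧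
      ∑ t, N.loadCost (x t) + ∑ v, k v * N.loadCost (Pi.single v N.capacity) ≤ N.opt d := by
  obtain ⟨m, x₀, h1, h2, h3⟩ := N.exists_optimal_loads hQ d
  -- With the total support size minimal, an exchange shows that two loads never share two vertices.
  -- A load on at least two vertices is then determined by a pair of them, whence `|V|²`; the loads
  -- at a single vertex are replaced by full ones.
  obtain ⟨x, ⟨hx1, hx2, hx3⟩, hmin⟩ := WellFounded.has_min
    (measure fun x : Fin m → V → ℕ => ∑ t, (loadSupport (x t)).card).wf
    {x | (∀ t, ∑ v, x t v ≤ N.capacity) ∧ (∀ v, ∑ t, x t v = d v) ∧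
      ∑ t, N.loadCost (x t) ≤ N.opt d} ⟨x₀, h1, h2, h3⟩
  have hpair : ∀ t₁ t₂, ∀ u v, u ≠ v → u ∈ loadSupport (x t₁) → v ∈ loadSupport (x t₁) →
      u ∈ loadSupport (x t₂) → v ∈ loadSupport (x t₂) → t₁ = t₂ := by
    intro t₁ t₂ u v huv h1u h1v h2u h2v
    by_contra ht
    simp only [mem_loadSupport] at h1u h1v h2u h2v
    obtain ⟨y, hy1, hy2, hy3, hy4⟩ := exists_exchange x ht huv h1u h1v h2u h2v
    refine hmin y ⟨fun t => hy1 t ▸ hx1 t, fun v => (hy2 v).trans (hx2 v), ?_⟩ hy4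
    exact (Finset.sum_le_sum fun t _ => N.loadCost_mono_support (hy3 t)).trans hx3
  set M : Finset (Fin m) := univ.filter fun t => 1 < (loadSupport (x t)).card with hM
  have hsingle : ∀ t, t ∉ M → ∀ v, x t v ≠ 0 → loadSupport (x t) = {v} := by
    intro t ht v hv
    simp only [hM, mem_filter, mem_univ, true_and, not_lt] at ht
    have hvs := mem_loadSupport.2 hv
    exact Finset.Subset.antisymm (fun w hw => mem_singleton.2 (card_le_one.1 ht w hw v hvs))
      (singleton_subset_iff.2 hvs)
  have hMs : ∀ t ∈ M, ∀ v, loadSupport (x t) ≠ {v} := by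
    intro t ht v h
    simp [hM, h] at ht
  refine ⟨M, inferInstance, fun t => x t, fun v => (univ.filter fun t => loadSupport (x t) = {v}).card,
    ?_, fun t => hx1 t, fun v => ?_, ?_⟩
  · have hex : ∀ t : M, ∃ q : V × V, q.1 ≠ q.2 ∧ q.1 ∈ loadSupport (x t) ∧
        q.2 ∈ loadSupport (x t) := by
      rintro ⟨t, ht⟩
      obtain ⟨u, hu, v, hv, huv⟩ := one_lt_card.1 (by simpa [hM] using ht)
      exact ⟨(u, v), huv, hu, hv⟩
    choose f hf using hex
    rw [sq, ← Fintype.card_prod]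
    refine Fintype.card_le_of_injective f fun t t' h => ?_
    have h1 := hf t
    have h2 := hf t'
    rw [← h] at h2
    exact Subtype.ext (hpair t t' _ _ h1.1 h1.2.1 h1.2.2 h2.2.1 h2.2.2)
  · beta_reduce
    rw [← hx2 v, Finset.sum_coe_sort M fun t => x t v, card_filter, Finset.sum_mul,
      ← Finset.sum_filter_add_sum_filter_not univ (· ∈ M) fun t => x t v]
    refine add_le_add (le_of_eq ?_) ?_
    · simp
    · refine le_trans (Finset.sum_le_sum (g := fun t =>
        (if loadSupport (x t) = {v} then 1 else 0) * N.capacity) fun t ht => ?_)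
        (Finset.sum_le_sum_of_subset (filter_subset _ _))
      by_cases hv : x t v = 0
      · rw [hv]; exact Nat.zero_le _
      · rw [if_pos (hsingle t (mem_filter.1 ht).2 v hv), one_mul]
        exact (Finset.single_le_sum (fun _ _ => Nat.zero_le _) (mem_univ v)).trans (hx1 t)
  · refine le_trans ?_ hx3
    rw [Finset.sum_coe_sort M fun t => N.loadCost (x t), ← Finset.sum_filter_add_sum_filter_not
      univ (· ∈ M) fun t => N.loadCost (x t)]
    refine add_le_add (le_of_eq (by simp)) ?_
    simp only [card_filter, Finset.sum_mul]
    rw [Finset.sum_comm, ← Finset.sum_filter_add_sum_filter_not univ (· ∈ M)]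
    rw [Finset.sum_eq_zero (s := univ.filter (· ∈ M)), zero_add]
    · refine Finset.sum_le_sum fun t _ => ?_
      by_cases h : ∃ v, loadSupport (x t) = {v}
      · obtain ⟨v, hv⟩ := h
        rw [Finset.sum_eq_single v]
        · rw [if_pos hv, one_mul]
          refine N.loadCost_mono_support fun w hw => ?_
          have : w = v := by
            by_contra hne; exact hw (Pi.single_eq_of_ne hne _)
          rw [this, ← mem_loadSupport, hv]
          exact mem_singleton_self v
        · intro w _ hw
          rw [if_neg, zero_mul]
          rw [hv]
          exact fun h => hw (singleton_injective h).symm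
        · simp
      · rw [Finset.sum_eq_zero]
        · exact Nat.zero_le _
        · intro v _
          rw [if_neg (fun hv => h ⟨v, hv⟩), zero_mul]
    · intro t ht
      refine Finset.sum_eq_zero fun v _ => ?_
      rw [if_neg (hMs t (by simpa using ht) v), zero_mul]

end Reduction

/-! ### Assembling the solution, and numerical estimates. -/

section Assembly

variable {V : Type*} [Fintype V] (N : TreeNetwork V)

/-- The load `x`, completed at the depot to a full load. -/
noncomputable def fillDepot (x : V → ℕ) (v : V) : ℕ := by
  classical exact x v + if v = N.depot then N.capacity - ∑ u, x u else 0

theorem le_fillDepot (x : V → ℕ) (v : V) : x v ≤ N.fillDepot x v := Nat.le_add_right _ _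

theorem sum_fillDepot {x : V → ℕ} (hx : ∑ v, x v ≤ N.capacity) :
    ∑ v, N.fillDepot x v = N.capacity := by
  classical
  simp only [fillDepot, sum_add_distrib, sum_ite_eq', mem_univ, if_true]
  omega

theorem cov_fillDepot (x : V → ℕ) {v : V} (hv : v ≠ N.depot) :
    N.cov (N.fillDepot x) v = N.cov x v := by
  refine Finset.sum_congr rfl fun u hu => ?_
  have hu' : u ≠ N.depot := by
    rintro rfl
    have := N.depth_le_of_mem_subtree hu
    rw [depth_depot, Nat.le_zero, depth_eq_zero] at this
    exact hv this
  simp [fillDepot, hu']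

theorem loadCost_fillDepot (x : V → ℕ) : N.loadCost (N.fillDepot x) ≤ N.loadCost x :=
  N.loadCost_mono fun v hv h => by rwa [N.cov_fillDepot x hv] at h

theorem cov_single [DecidableEq V] (u v : V) (q : ℕ) :
    N.cov (Pi.single u q) v = 0 ∨ N.cov (Pi.single u q) v = q := by
  simp only [cov, Pi.single_apply, sum_ite_eq']
  split_ifs <;> simp

variable {ε L : ℝ} {g : ℕ}

theorem card_image_bucket_capacity_le {I : Type*} [Fintype I] (hε : 0 < ε) {Q : ℕ} (hQ : 0 < Q)
    {s : I → ℕ} (hs : ∀ j, s j ≤ Q) :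
    ((univ.filter fun j => bucketIndex ε Q (s j) = bucketIndex ε Q Q).image s).card ≤ 1 := by
  refine (card_le_card (t := {Q}) fun a ha => ?_).trans (card_singleton Q).le
  obtain ⟨j, hj, rfl⟩ := mem_image.1 ha
  have hj : bucketIndex ε Q (s j) = bucketIndex ε Q Q := by simpa using hj
  have h1 := inBucketSize_bucketIndex hε hQ (hs j)
  rw [hj] at h1
  exact mem_singleton.2
    ((inBucketSize_bucketIndex hε hQ le_rfl).eq_capacity h1 (hs j))

/-- Adding empty and full sizes does not matter. -/
theorem HasFewSizes.sum_elim {ι κ : Type*} [Fintype ι] [Fintype κ] (hε : 0 < ε) {Q : ℕ}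
    (hQ : 0 < Q) (hg : 1 ≤ g) {s : ι ⊕ κ → ℕ} (hs : ∀ j, s j ≤ Q)
    (h : HasFewSizes ε Q L g fun t => s (Sum.inl t)) (hr : ∀ e, s (Sum.inr e) = 0 ∨
      s (Sum.inr e) = Q) : HasFewSizes ε Q L g s := by
  classical
  intro i hi
  by_cases hiQ : bucketIndex ε Q Q = i
  · right
    rw [← hiQ]
    exact (card_image_bucket_capacity_le hε hQ hs).trans hg
  · have himg : (univ.filter fun T => bucketIndex ε Q (s T) = i) =
        (univ.filter fun t => bucketIndex ε Q (s (Sum.inl t)) = i).image Sum.inl := by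
      ext T
      rcases T with t | e
      · simp
      · have h0 := (bucketIndex_eq_zero_iff hε hQ (Nat.zero_le Q)).2 rfl
        simp only [mem_filter, mem_univ, true_and, mem_image, reduceCtorEq, and_false,
          exists_false, iff_false]
        rcases hr e with h | h <;> rw [h]
        · omega
        · exact hiQ
    rw [himg, card_image_of_injective _ Sum.inl_injective, image_image]
    exact h i hi

/-- A natural-number list of group sizes covering a nonempty set of at most `g` sizes. -/
theorem exists_monotone_cover (G : Finset ℕ) (hG : G.Nonempty) (hg : G.card ≤ g) :
    ∃ h : Fin g → ℕ, Monotone h ∧ (∀ j, h j ∈ G) ∧ ∀ a ∈ G, ∃ j, a = h j := by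
  have hc : 0 < G.card := hG.card_pos
  refine ⟨fun j => G.orderEmbOfFin rfl ⟨min j (G.card - 1), by omega⟩, fun i j hij => ?_,
    fun j => G.orderEmbOfFin_mem rfl _, fun a ha => ?_⟩
  · refine (G.orderEmbOfFin rfl).monotone ?_
    have : (i : ℕ) ≤ j := hij
    simp only [Fin.mk_le_mk]
    omega
  · have hr : a ∈ Set.range (G.orderEmbOfFin rfl) := by
      rw [G.range_orderEmbOfFin rfl]; exact ha
    obtain ⟨⟨j, hj⟩, rfl⟩ := hr
    refine ⟨⟨j, by omega⟩, ?_⟩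
    congr 2
    simp only
    omega

theorem small_or_hasGroupSizes {I : Type*} [Fintype I] (hε : 0 < ε) (hQ : 0 < N.capacity)
    {α : ℝ} (hα : 0 ≤ α * Real.log (Fintype.card V) ^ 3 / ε ^ 2)
    (T : I → N.Tour) (v : V) (h : HasFewSizes ε N.capacity
      (α * Real.log (Fintype.card V) ^ 3 / ε ^ 2) g fun j => (T j).coverage v) (i : ℕ)
    (hi : 1 ≤ i) :
    IsSmallBucket α ε (univ.val.map T) v i ∨ HasGroupSizes g ε (univ.val.map T) v i := by
  classical
  have hcov : ∀ j, (T j).coverage v ≤ N.capacity := fun j =>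
    (N.cov_le_sum (T j).load v).trans (T j).load_le
  have hb : ∀ j, Tour.InBucket ε v i (T j) ↔
      bucketIndex ε N.capacity ((T j).coverage v) = i := fun j =>
    inBucketSize_iff hε hQ (hcov j)
  set B : Finset I := univ.filter fun j => bucketIndex ε N.capacity ((T j).coverage v) = i with hB
  have hcount : bucketCount ε (univ.val.map T) v i = B.card := by
    rw [bucketCount, Multiset.countP_map, hB, Finset.card_def, Finset.filter_val]
    congr 1
    exact Multiset.filter_congr fun j _ => hb j
  rcases h i hi with h | h
  · left
    rw [IsSmallBucket, hcount]
    exact h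
  -- An empty bucket must count as small: past the last threshold its interval is empty, and no
  -- group sizes exist.
  · rcases B.eq_empty_or_nonempty with h0 | h0
    · left
      rw [IsSmallBucket, hcount, h0]
      simpa using hα
    · right
      obtain ⟨f, h1, h2, h3⟩ := exists_monotone_cover _ (h0.image fun j => (T j).coverage v) h
      refine ⟨f, h1, fun j => ?_, fun t ht hbt => ?_⟩
      · obtain ⟨j', hj', hj⟩ := mem_image.1 (h2 j)
        rw [← hj]
        exact (hb j').2 (by simpa [hB] using hj')
      · obtain ⟨j, -, rfl⟩ := Multiset.mem_map.1 ht
        exact h3 _ (mem_image_of_mem _ (by simpa [hB] using (hb j).1 hbt))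

/-- The summand 1 is the size 0. Every other size lies in one of the buckets bounded by
`bucketIndex_le`, each with at most `L` or at most `g` sizes. -/
theorem card_image_le_of_hasFewSizes {I : Type*} [Fintype I] (hε : 0 < ε) (hε1 : ε < 1) {Q : ℕ}
    (hQ : 0 < Q) (hL : 0 ≤ L) {s : I → ℕ} (hs : ∀ j, s j ≤ Q) (h : HasFewSizes ε Q L g s) :
    ((univ.image s).card : ℝ) ≤ 1 + (2 + 1 / ε + 2 * Real.log Q / ε) * (L + g) := by
  classical
  set M : ℝ := 2 + 1 / ε + 2 * Real.log Q / ε with hM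
  have hM0 : 0 ≤ M := by
    have := Real.log_natCast_nonneg Q
    positivity
  have hsub : univ.image s ⊆ {0} ∪ (Icc 1 ⌊M⌋₊).biUnion fun i =>
      (univ.filter fun j => bucketIndex ε Q (s j) = i).image s := by
    intro a ha
    obtain ⟨j, -, rfl⟩ := mem_image.1 ha
    by_cases h0 : s j = 0
    · simp [h0]
    · refine mem_union_right _ (mem_biUnion.2 ⟨bucketIndex ε Q (s j), mem_Icc.2 ⟨?_, ?_⟩,
        mem_image_of_mem _ (by simp)⟩)
      · exact Nat.one_le_iff_ne_zero.2 fun h => h0 ((bucketIndex_eq_zero_iff hε hQ (hs j)).1 h)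
      · exact Nat.le_floor (bucketIndex_le hε hε1 hQ (hs j))
  have h1 : (univ.image s).card ≤ 1 + ∑ i ∈ Icc 1 ⌊M⌋₊,
      ((univ.filter fun j => bucketIndex ε Q (s j) = i).image s).card :=
    (card_le_card hsub).trans ((card_union_le _ _).trans
      (add_le_add (card_singleton _).le card_biUnion_le))
  have h2 : ((univ.image s).card : ℝ) ≤ 1 + ∑ i ∈ Icc 1 ⌊M⌋₊,
      (((univ.filter fun j => bucketIndex ε Q (s j) = i).image s).card : ℝ) := by exact_mod_cast h1
  refine h2.trans (add_le_add le_rfl ?_)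
  calc _ ≤ ∑ i ∈ Icc 1 ⌊M⌋₊, (L + g) := by
        refine Finset.sum_le_sum fun i hi => ?_
        rcases h i (mem_Icc.1 hi).1 with h | h
        · have h3 : (((univ.filter fun j => bucketIndex ε Q (s j) = i).image s).card : ℝ) ≤
            (univ.filter fun j => bucketIndex ε Q (s j) = i).card := by
            exact_mod_cast card_image_le
          have : (0 : ℝ) ≤ g := Nat.cast_nonneg g
          linarith
        · have h3 : (((univ.filter fun j => bucketIndex ε Q (s j) = i).image s).card : ℝ) ≤ g := by
            exact_mod_cast h
          linarith
    _ = (⌊M⌋₊ : ℝ) * (L + g) := by simp [mul_add]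
    _ ≤ M * (L + g) := mul_le_mul_of_nonneg_right (Nat.floor_le hM0) (by positivity)

/-- For `O > 0` the price makes `n²` tours cost `ε O / 200` together, which fits between `99/25` and
`4`. For `O = 0` the price only has to keep the total below 1, since costs are integers. -/
theorem exists_tour_price {ε : ℝ} (hε : 0 < ε) (hε1 : ε < 1) (O n : ℕ) (hn : 0 < n) :
    ∃ c : ℝ, 0 < c ∧ 5 * (O + c * n ^ 2) ≤ c * (1005 * n ^ 2 / ε) ∧
      ∀ F : ℕ, (F : ℝ) ≤ (1 + 99 / 25 * ε) * (O + c * n ^ 2) → (F : ℝ) ≤ (1 + 4 * ε) * O := by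
  have hn0 : (0 : ℝ) < n := by exact_mod_cast hn
  rcases Nat.eq_zero_or_pos O with rfl | hO
  · refine ⟨1 / (10 * n ^ 2), by positivity, ?_, fun F hF => ?_⟩
    · have h1 : 5 * (((0 : ℕ) : ℝ) + 1 / (10 * n ^ 2) * n ^ 2) = 1 / 2 := by
        push_cast; field_simp; norm_num
      have h2 : 1 / (10 * n ^ 2) * (1005 * n ^ 2 / ε) = 201 / 2 / ε := by
        field_simp; norm_num
      rw [h1, h2, le_div_iff₀ hε]
      linarith
    · have h1 : ((0 : ℕ) : ℝ) + 1 / (10 * n ^ 2) * n ^ 2 = 1 / 10 := by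
        push_cast; field_simp; norm_num
      rw [h1] at hF
      have h2 : (F : ℝ) < 1 := by linarith
      have h3 : F = 0 := by
        have : F < 1 := by exact_mod_cast h2
        omega
      simp [h3]
  · have hO0 : (0 : ℝ) < O := by exact_mod_cast hO
    have hcn : 1 / 200 * ε * O / n ^ 2 * n ^ 2 = 1 / 200 * ε * O := by field_simp
    refine ⟨1 / 200 * ε * O / n ^ 2, by positivity, ?_, fun F hF => ?_⟩
    · have h2 : 1 / 200 * ε * O / n ^ 2 * (1005 * n ^ 2 / ε) = 1005 / 200 * O := by
        field_simp
      rw [hcn, h2]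
      nlinarith
    · rw [hcn] at hF
      refine hF.trans ?_
      have : (1 + 99 / 25 * ε) * (O + 1 / 200 * ε * O) =
          (1 + 99 / 25 * ε) * (1 + 1 / 200 * ε) * O := by ring
      rw [this]
      exact mul_le_mul_of_nonneg_right (by nlinarith) hO0.le

/-- The summand `40000 δ` pulls the exponential below `n ^ (-24)`, because `h ε ≤ δ log² n`. The
summand 4000 turns the last hypothesis into `1/ε ≤ n²`, so that the product is at most `2010 / n ^
19`. -/
theorem union_bound {δ ε h : ℝ} {n : ℕ} (hδ : 0 < δ) (hε : 0 < ε) (hn : 2 ≤ n)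
    (hh : 0 < h) (hhδ : h ≤ δ * Real.log n ^ 2 / ε)
    (hL : (4000 + 40000 * δ) * Real.log n ^ 3 / ε ^ 2 < 1005 * n ^ 2 / ε) :
    2 * (n * (1005 * (n : ℝ) ^ 2 / ε)) * Real.exp (-(1 / 800) * (53 / 100 * ε / h) *
      ((4000 + 40000 * δ) * Real.log n ^ 3 / ε ^ 2)) ≤ 3 / 500 := by
  have hn2 : (2 : ℝ) ≤ n := by exact_mod_cast hn
  have hn0 : (0 : ℝ) < n := by linarith
  have hlog : 0.69 ≤ Real.log n := by
    have := Real.log_two_gt_d9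
    have := Real.log_le_log (by norm_num) hn2
    linarith
  have hlog3 : 0.69 ^ 3 ≤ Real.log n ^ 3 := pow_le_pow_left₀ (by norm_num) hlog 3
  have hinv : 1 / ε ≤ (n : ℝ) ^ 2 := by
    rw [div_lt_div_iff₀ (by positivity) hε] at hL
    have h1 : (4000 + 40000 * δ) * Real.log n ^ 3 < 1005 * n ^ 2 * ε := by
      have h2 : (4000 + 40000 * δ) * Real.log n ^ 3 * ε < 1005 * n ^ 2 * ε * ε := by
        calc _ < _ := hL
          _ = _ := by ring
      exact lt_of_mul_lt_mul_right h2 hε.le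
    rw [div_le_iff₀ hε]
    have : 0 ≤ δ * Real.log n ^ 3 := by positivity
    norm_num at hlog3
    nlinarith
  have hexp : -(1 / 800) * (53 / 100 * ε / h) * ((4000 + 40000 * δ) * Real.log n ^ 3 / ε ^ 2) ≤
      -((24 : ℕ) * Real.log n) := by
    have h1 : -(1 / 800) * (53 / 100 * ε / h) * ((4000 + 40000 * δ) * Real.log n ^ 3 / ε ^ 2) =
        -(53 / 80000 * (4000 + 40000 * δ) * Real.log n ^ 3 / (h * ε)) := by
      field_simp; norm_num
    rw [h1, neg_le_neg_iff, le_div_iff₀ (by positivity)]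
    rw [le_div_iff₀ hε] at hhδ
    have hl0 : 0 < Real.log n := by linarith
    calc ((24 : ℕ) : ℝ) * Real.log n * (h * ε) ≤ (24 : ℕ) * Real.log n * (δ * Real.log n ^ 2) :=
          mul_le_mul_of_nonneg_left hhδ (by positivity)
      _ = 24 * δ * Real.log n ^ 3 := by push_cast; ring
      _ ≤ _ := mul_le_mul_of_nonneg_right (by linarith) (by positivity)
  have hexp2 := Real.exp_le_exp.2 hexp
  rw [Real.exp_neg, Real.exp_nat_mul, Real.exp_log hn0] at hexp2
  have h19 : (2 : ℝ) ^ 19 ≤ (n : ℝ) ^ 19 := pow_le_pow_left₀ (by norm_num) hn2 19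
  calc _ ≤ 2 * (n * (1005 * (n : ℝ) ^ 2 / ε)) * ((n : ℝ) ^ 24)⁻¹ :=
        mul_le_mul_of_nonneg_left hexp2 (by positivity)
    _ = 2010 * (n : ℝ) ^ 3 * ((n : ℝ) ^ 24)⁻¹ * (1 / ε) := by ring
    _ ≤ 2010 * (n : ℝ) ^ 3 * ((n : ℝ) ^ 24)⁻¹ * n ^ 2 :=
        mul_le_mul_of_nonneg_left hinv (by positivity)
    _ = 2010 / (n : ℝ) ^ 19 := by field_simp
    _ ≤ 3 / 500 := by
        rw [div_le_iff₀ (by positivity)]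
        norm_num at h19
        linarith

theorem sizes_bound {δ ε α lQ lg G : ℝ} (hδ : 0 < δ) (hε : 0 < ε) (hε1 : ε < 1) (hα : 0 ≤ α)
    (hlQ : 1 / 2 ≤ lQ) (hlg : 1 / 2 ≤ lg) (hG : G ≤ 2 * δ * lg ^ 2 / ε ^ 2 + 1) :
    1 + (2 + 1 / ε + 2 * lQ / ε) * (α * lg ^ 3 / ε ^ 2 + G) ≤
      (8 * (α + 4 * δ + 8) + 16) * (lQ * lg ^ 3 / ε ^ 3) := by
  have hε3 : ε ^ 3 ≤ 1 := pow_le_one₀ hε.le hε1.le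
  have hε2 : ε ^ 2 ≤ 1 := pow_le_one₀ hε.le hε1.le
  have h3 : (1 / 2) ^ 3 ≤ lg ^ 3 := pow_le_pow_left₀ (by norm_num) hlg 3
  have hlg2 : lg ^ 2 ≤ 2 * lg ^ 3 := by nlinarith [sq_nonneg lg]
  have hlg0 : 0 < lg := by linarith
  have hlQ0 : 0 < lQ := by linarith
  have e1 : 1 ≤ 16 * (lQ * lg ^ 3 / ε ^ 3) := by
    rw [mul_div_assoc', le_div_iff₀ (by positivity)]
    nlinarith
  have e2 : 2 + 1 / ε + 2 * lQ / ε ≤ 8 * lQ / ε := by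
    rw [le_div_iff₀ hε]
    have : (2 + 1 / ε + 2 * lQ / ε) * ε = 2 * ε + 1 + 2 * lQ := by field_simp
    rw [this]; linarith
  have e3 : α * lg ^ 3 / ε ^ 2 + G ≤ (α + 4 * δ + 8) * lg ^ 3 / ε ^ 2 := by
    have h1 : (1 : ℝ) ≤ 8 * lg ^ 3 / ε ^ 2 := by
      rw [le_div_iff₀ (by positivity)]; linarith
    have h2 : 2 * δ * lg ^ 2 / ε ^ 2 ≤ 4 * δ * lg ^ 3 / ε ^ 2 := by
      refine div_le_div_of_nonneg_right ?_ (by positivity)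
      have := mul_le_mul_of_nonneg_left hlg2 (by positivity : 0 ≤ 2 * δ)
      linarith
    have h4 : (α + 4 * δ + 8) * lg ^ 3 / ε ^ 2 =
      α * lg ^ 3 / ε ^ 2 + 4 * δ * lg ^ 3 / ε ^ 2 + 8 * lg ^ 3 / ε ^ 2 := by ring
    linarith
  have e4 : (2 + 1 / ε + 2 * lQ / ε) * (α * lg ^ 3 / ε ^ 2 + G) ≤
      8 * lQ / ε * ((α + 4 * δ + 8) * lg ^ 3 / ε ^ 2) := by
    refine (mul_le_mul_of_nonneg_left e3 (by positivity)).trans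
      (mul_le_mul_of_nonneg_right e2 (by positivity))
  have e5 : 8 * lQ / ε * ((α + 4 * δ + 8) * lg ^ 3 / ε ^ 2) =
      8 * (α + 4 * δ + 8) * (lQ * lg ^ 3 / ε ^ 3) := by field_simp
  linarith

end Assembly

end TreeNetwork

end

theorem mainTheorem7 (δ : ℝ) (hδ : 0 < δ) :
    ∃ α C : ℝ, max 1 (12 * δ) ≤ α ∧ 0 < C ∧
      ∀ (V : Type*) [Fintype V] (N : TreeNetwork V) (d : V → ℕ) (ε : ℝ),
        0 < ε → ε < 1 → 2 ≤ Fintype.card V → 2 ≤ N.capacity →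
        (∀ v, v ≠ N.depot → 1 ≤ d v) →
        (∀ v, (N.graph.dist N.depot v : ℝ) ≤ δ * Real.log (Fintype.card V) ^ 2 / ε) →
        ∃ (d' : V → ℕ) (S : Multiset N.Tour),
          (∀ v, 1 ≤ d' v) ∧ (∀ v, d v ≤ d' v) ∧
          TreeNetwork.IsSolution S d' ∧
          (TreeNetwork.cost S : ℝ) ≤ (1 + 4 * ε) * (N.opt d : ℝ) ∧
          (∀ v, ((TreeNetwork.sizes S v).card : ℝ) ≤
            C * (Real.log N.capacity * Real.log (Fintype.card V) ^ 3 / ε ^ 3)) ∧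
          ∀ v i, 1 ≤ i →
            TreeNetwork.IsSmallBucket α ε S v i ∨
            TreeNetwork.HasGroupSizes
              ⌈2 * δ * Real.log (Fintype.card V) ^ 2 / ε ^ 2⌉₊ ε S v i := by
  classical
  refine ⟨4000 + 40000 * δ, 8 * ((4000 + 40000 * δ) + 4 * δ + 8) + 16,
    max_le (by linarith) (by linarith), by positivity, ?_⟩
  intro V _ N d ε hε hε1 hn hQ2 hd hdist
  set n := Fintype.card V with hndef
  set α : ℝ := 4000 + 40000 * δ with hα
  set lg := Real.log n with hlg
  set L : ℝ := α * lg ^ 3 / ε ^ 2 with hL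
  set g := ⌈2 * δ * lg ^ 2 / ε ^ 2⌉₊ with hg
  have hQ : 0 < N.capacity := by omega
  have hα0 : 0 < α := by positivity
  have hlog : ∀ m : ℕ, 2 ≤ m → 1 / 2 ≤ Real.log m := by
    intro m hm
    have h1 := Real.log_two_gt_d9
    have h2 := Real.log_le_log (by norm_num) (show (2 : ℝ) ≤ m by exact_mod_cast hm)
    linarith
  have hlg2 : 1 / 2 ≤ lg := hlog n hn
  have hL0 : 0 ≤ L := by positivity
  obtain ⟨v₀, -, hv₀⟩ := Finset.exists_max_image Finset.univ N.depth ⟨N.depot, Finset.mem_univ _⟩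
  set H := N.depth v₀ with hH
  have hdepth : ∀ v, N.depth v ≤ H := fun v => hv₀ v (Finset.mem_univ v)
  have hH1 : 1 ≤ H := by
    obtain ⟨v, hv⟩ := Fintype.exists_ne_of_one_lt_card (by omega : 1 < Fintype.card V) N.depot
    have h1 := hdepth v
    have h2 := mt N.depth_eq_zero.1 hv
    omega
  have hH0 : (0 : ℝ) < H := by exact_mod_cast hH1
  have hHδ : (H : ℝ) ≤ δ * lg ^ 2 / ε := hdist v₀
  have hgH : 2 * H / ε ≤ (g : ℝ) := by
    refine le_trans ?_ (Nat.le_ceil _)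
    calc 2 * H / ε ≤ 2 * (δ * lg ^ 2 / ε) / ε := by gcongr
      _ = 2 * δ * lg ^ 2 / ε ^ 2 := by field_simp
  have hg1 : 1 ≤ g := Nat.one_le_ceil_iff.2 (by positivity)
  obtain ⟨c, hc, hcK, hcF⟩ := TreeNetwork.exists_tour_price hε hε1 (N.opt d) n (by omega)
  obtain ⟨ι, _, x, k, hcard, hx, hdem, hcost⟩ := N.exists_reduced_loads hQ d
  set s₀ := ∑ v, k v * N.loadCost (Pi.single v N.capacity) with hs₀
  have hΦ : ∑ t, ((N.loadCost (x t) : ℝ) + c) + s₀ ≤ N.opt d + c * n ^ 2 := by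
    have h1 : (∑ t, (N.loadCost (x t) : ℝ)) + s₀ ≤ N.opt d := by exact_mod_cast hcost
    have h2 : (Fintype.card ι : ℝ) ≤ n ^ 2 := by exact_mod_cast hcard
    have h3 := mul_le_mul_of_nonneg_left h2 hc.le
    rw [Finset.sum_add_distrib, Finset.sum_const, Finset.card_univ, nsmul_eq_mul]
    linarith
  have hs₀0 : (0 : ℝ) ≤ s₀ := Nat.cast_nonneg _
  obtain ⟨ι', _, y, hy1, hy2, hy3, hy4⟩ := N.exists_rounding (L := L) (g := g)
    (K := 1005 * n ^ 2 / ε) hε hε1 hQ hL0 hH1 hgH hdepth hc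
    (fun h => TreeNetwork.union_bound hδ hε hn hH0 hHδ h) x hx (by linarith)
  -- The rounded loads, the full loads set aside, and a free full load at the depot, which makes the
  -- demand there positive even if `d` vanishes.
  set W : ι' ⊕ ((Σ v, Fin (k v)) ⊕ Unit) → V → ℕ := Sum.elim y
    (Sum.elim (fun q => Pi.single q.1 N.capacity) fun _ => Pi.single N.depot N.capacity) with hW
  have hWQ : ∀ j, ∑ v, W j v ≤ N.capacity := by
    rintro (t | q | _)
    · exact hy1 t
    · simp [hW]
    · simp [hW]
  have hT : ∀ j, ∃ t : N.Tour, t.load = N.fillDepot (W j) ∧ t.cost ≤ N.loadCost (W j) := by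
    intro j
    obtain ⟨t, h1, h2⟩ := N.exists_tour (N.fillDepot (W j)) (N.sum_fillDepot (hWQ j)).le
    exact ⟨t, h1, h2.le.trans (N.loadCost_fillDepot _)⟩
  choose T hTl hTc using hT
  have hcovT : ∀ j v, (T j).coverage v = N.cov (N.fillDepot (W j)) v := fun j v => by
    rw [TreeNetwork.Tour.coverage, hTl]; rfl
  have hcovQ : ∀ v j, (T j).coverage v ≤ N.capacity := fun v j => by
    rw [hcovT]
    exact (N.cov_le_sum _ v).trans (N.sum_fillDepot (hWQ j)).le
  have hfew : ∀ v, TreeNetwork.HasFewSizes ε N.capacity L g fun j => (T j).coverage v := by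
    intro v
    by_cases hv : v = N.depot
    · subst hv
      have h1 : (fun j => (T j).coverage N.depot) = fun _ => N.capacity := by
        ext j
        rw [hcovT, N.cov_depot, N.sum_fillDepot (hWQ j)]
      rw [h1]
      intro i _
      right
      refine le_trans (Finset.card_le_one.2 ?_) hg1
      simp only [Finset.mem_image]
      rintro _ ⟨_, -, rfl⟩ _ ⟨_, -, rfl⟩
      rfl
    · refine TreeNetwork.HasFewSizes.sum_elim hε hQ hg1 (hcovQ v) ?_ ?_
      · have h1 : (fun t => (T (Sum.inl t)).coverage v) = fun t => N.cov (y t) v := by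
          ext t
          rw [hcovT, N.cov_fillDepot _ hv]
          rfl
        rw [h1]
        exact hy4 v hv
      · rintro (q | _)
        · rw [hcovT, N.cov_fillDepot _ hv]
          exact N.cov_single _ _ _
        · rw [hcovT, N.cov_fillDepot _ hv]
          exact N.cov_single _ _ _
  have hsum : ∀ v, ((Finset.univ.val.map T).map fun t => t.load v).sum =
      ∑ j, N.fillDepot (W j) v := by
    intro v
    rw [Multiset.map_map]
    exact Finset.sum_congr rfl fun j _ => by rw [Function.comp, hTl]
  have hdW : ∀ v, d v ≤ ∑ j, N.fillDepot (W j) v := by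
    intro v
    refine le_trans ?_ (Finset.sum_le_sum fun j _ => N.le_fillDepot (W j) v)
    rw [Fintype.sum_sum_type, Fintype.sum_sum_type, Fintype.sum_sigma]
    refine (hdem v).trans (add_le_add (hy2 v) ?_)
    refine le_trans (le_of_eq ?_) (Nat.le_add_right _ _)
    simp [hW, Pi.single_apply]
  refine ⟨fun v => ∑ j, N.fillDepot (W j) v, Finset.univ.val.map T, fun v => ?_, hdW, hsum, ?_,
    fun v => ?_, fun v i hi =>
      N.small_or_hasGroupSizes hε hQ hL0 T v (hfew v) i hi⟩
  · by_cases hv : v = N.depot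
    · subst hv
      refine le_trans ?_ (Finset.single_le_sum (fun _ _ => Nat.zero_le _)
        (Finset.mem_univ (Sum.inr (Sum.inr ()))))
      refine le_trans ?_ (N.le_fillDepot _ _)
      simp only [hW, Sum.elim_inr, Pi.single_eq_same]
      omega
    · exact (hd v hv).trans (hdW v)
  · refine hcF _ ?_
    have hroot : N.loadCost (Pi.single N.depot N.capacity) = 0 := by
      have h1 := N.loadCost_fillDepot (fun _ => 0)
      have h2 : N.fillDepot (fun _ => 0) = Pi.single N.depot N.capacity := by
        ext v; simp [TreeNetwork.fillDepot, Pi.single_apply]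
      rw [h2] at h1
      refine Nat.le_zero.1 (h1.trans (le_of_eq ?_))
      simp [TreeNetwork.loadCost, TreeNetwork.cov]
    have h1 : TreeNetwork.cost (Finset.univ.val.map T) ≤ ∑ t, N.loadCost (y t) + s₀ := by
      rw [TreeNetwork.cost, Multiset.map_map]
      refine (Finset.sum_le_sum fun j _ => hTc j).trans (le_of_eq ?_)
      rw [Fintype.sum_sum_type, Fintype.sum_sum_type, Fintype.sum_sigma]
      simp [hW, hroot, hs₀]
    have h2 : (TreeNetwork.cost (Finset.univ.val.map T) : ℝ) ≤
        ∑ t, (N.loadCost (y t) : ℝ) + s₀ := by exact_mod_cast h1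
    have h3 : ∑ t, (N.loadCost (y t) : ℝ) ≤ ∑ t, ((N.loadCost (y t) : ℝ) + c) :=
      Finset.sum_le_sum fun _ _ => by linarith
    have h4 := mul_le_mul_of_nonneg_left hΦ (by positivity : 0 ≤ 1 + 99 / 25 * ε)
    have h5 : 0 ≤ 99 / 25 * ε * s₀ := by positivity
    linarith
  · have h1 : TreeNetwork.sizes (Finset.univ.val.map T) v =
        Finset.univ.image fun j => (T j).coverage v := by
      rw [TreeNetwork.sizes, Multiset.map_map]; rfl
    rw [h1]
    refine (TreeNetwork.card_image_le_of_hasFewSizes hε hε1 hQ hL0 (hcovQ v) (hfew v)).trans ?_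
    exact TreeNetwork.sizes_bound hδ hε hε1 hα0.le (hlog _ hQ2) hlg2
      (Nat.ceil_lt_add_one (by positivity)).le
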